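/- Let $M$ be a (Hausdorff, second countable) $C^\infty$-manifold of dimension $n$ without boundary and $X$ a $C^\infty$ vector field on $M$. Write $\Lambda^k$ for the space of real $C^\infty$ differential $k$-forms on $M$, $i_X:\Lambda^{k+1}\to\Lambda^{k}$ for contraction with $X$ (and $i_X=0$ on $\Lambda^0$), $\nabla_X^k=d\,i_X+i_X\,d:\Lambda^k\to\Lambda^k$ for the Lie derivative, and $\Lambda_X^k=\{u\in\Lambda^k: i_Xu=0\}$, so that $\Lambda^0_X=\Lambda^0=C^\infty(M)$. Let $\nabla_X^{k,*}$ be the restriction of $\nabla_X^k$ to an operator $\Lambda_X^k\to\Lambda_X^k$; its image lies in $\mathrm{Im}(i_X)=i_X(\Lambda^{k+1})\subset\Lambda_X^k$. Put $$\mathrm{Coker}(\nabla_X^k)=\Lambda^k/\nabla_X^k(\Lambda^k),\quad \mathrm{Coker}(\nabla_X^{k,*})=\Lambda_X^k/\nabla_X^k(\Lambda_X^k),\quad C_X^k=\mathrm{Im}(i_X)/\mathrm{Im}(\nabla_X^{k,*})\subset \mathrm{Coker}(\nabla_X^{k,*}),$$ $$H_X^k=\{u\in\Lambda^k: du=0\}/d(\Lambda_X^{k-1}).$$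 A zero $x$ of $X$ has finite Milnor index if the algebra of germs at $x$ of $C^\infty$ functions modulo the ideal generated by the components of $X$ in local coordinates is finite-dimensional. The field $X$ is of finite type if all its zeros are isolated and have finite Milnor index (in particular, if $X$ has no zeros). 1. Let $n\ge 1$ and let $X$ be of finite type. Every $n$-form is closed, and $i_X$ induces an isomorphism $H_X^n\cong C_X^{n-1}$. If moreover $n>1$ or $X$ has no zeros, then $d(\Lambda_X^{n-1})=\nabla_X^n(\Lambda^n)$, that is, $H_X^n=\mathrm{Coker}(\nabla_X^n)$. 2. Let $n\ge1$, let $X$ be of finite type, and suppose that its flow is measure-preserving in the sense that there is a nowhere vanishing $\sigma\in\Lambda^n$ with $\nabla_X^n\sigma=0$. Then $f\mapsto f\sigma$ induces an isomorphism $\mathrm{Coker}(\nabla_X^0)\cong H_X^n$. 3. If $X$ has no zeros, then $C_X^k=\mathrm{Coker}(\nabla_X^{k,*})$ for all $k\ge0$. 4. Suppose that all zeros of $X$ are non-degenerate (the Jacobian matrix of $X$ in local coordinates is invertible there; such zeros are isolated). Then $C_X^k=\mathrm{Coker}(\nabla_X^{k,*})$ for all $k>0$; the image of $i_X:\Lambda^1\to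 C^\infty(M)$ consists of all functions that vanish at the zeros of $X$; and the codimension of $C_X^0$ in $\mathrm{Coker}(\nabla_X^0)$ is the number of zeros of $X$ (it is finite if there are finitely many zeros, and infinite otherwise). -/

import Mathlib

open scoped Manifold ContDiff Topology

noncomputable section

namespace Novikov

variable {n : ℕ} {M : Type*} [TopologicalSpace M]
  [ChartedSpace (EuclideanSpace ℝ (Fin n)) M]

variable (n M) in
/-- Fields of alternating `k`-forms on the tangent spaces of the `n`-manifold `M`, with no
regularity. -/
def FormField (k : ℕ) : Type _ := ∀ x : M, TangentSpace (𝓡 n) x [⋀^Fin k]→L[ℝ] ℝ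

instance (k : ℕ) : AddCommGroup (FormField n M k) :=
  inferInstanceAs (AddCommGroup (∀ x : M, TangentSpace (𝓡 n) x [⋀^Fin k]→L[ℝ] ℝ))

instance (k : ℕ) : Module ℝ (FormField n M k) :=
  inferInstanceAs (Module ℝ (∀ x : M, TangentSpace (𝓡 n) x [⋀^Fin k]→L[ℝ] ℝ))

/-- The expression in the chart centred at `x₀` of a (not necessarily smooth) field `α` of
alternating `k`-forms on the tangent spaces of `M`: the pullback of `α` by the inverse chart. -/
def localForm {k : ℕ} (α : FormField n M k) (x₀ : M) :
    EuclideanSpace ℝ (Fin n) → EuclideanSpace ℝ (Fin n) [⋀^Fin k]→L[ℝ] ℝ :=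
  fun y => (α ((extChartAt (𝓡 n) x₀).symm y)).compContinuousLinearMap
    (mfderiv (𝓡 n) (𝓡 n) (extChartAt (𝓡 n) x₀).symm y)

/-- The expression in the chart centred at `x₀` of a vector field on `M`. -/
def localField (X : ∀ x : M, TangentSpace (𝓡 n) x) (x₀ : M) :
    EuclideanSpace ℝ (Fin n) → EuclideanSpace ℝ (Fin n) :=
  fun y => mfderiv (𝓡 n) (𝓡 n) (extChartAt (𝓡 n) x₀) ((extChartAt (𝓡 n) x₀).symm y)
    (X ((extChartAt (𝓡 n) x₀).symm y))

lemma localForm_add {k : ℕ} (α β : FormField n M k) (x₀ : M) :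
    localForm (α + β) x₀ = localForm α x₀ + localForm β x₀ := rfl

lemma localForm_smul {k : ℕ} (c : ℝ) (α : FormField n M k)
    (x₀ : M) : localForm (c • α) x₀ = c • localForm α x₀ := rfl

lemma localForm_zero {k : ℕ} (x₀ : M) :
    localForm (0 : FormField n M k) x₀ = 0 := rfl

variable (n M) in
/-- The real vector space of `C^∞` differential `k`-forms on the `n`-manifold `M`: fields of
alternating `k`-forms on the tangent spaces whose expressions in the charts are `C^∞`. -/
def forms (k : ℕ) : Submodule ℝ (FormField n M k) where
  carrier := {α | ∀ x₀ : M, ContDiffOn ℝ ∞ (localForm α x₀) (extChartAt (𝓡 n) x₀).target}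
  add_mem' {α β} hα hβ x₀ := by
    rw [localForm_add]
    exact (hα x₀).add (hβ x₀)
  zero_mem' x₀ := by
    rw [localForm_zero]
    exact contDiffOn_const
  smul_mem' c α hα x₀ := by
    rw [localForm_smul]
    exact contDiffOn_const.smul (hα x₀)

/-- The exterior derivative at `x`, computed in the chart centred at `x`. -/
def extDerivAt {k : ℕ} (α : FormField n M k) (x : M) :
    TangentSpace (𝓡 n) x [⋀^Fin (k + 1)]→L[ℝ] ℝ :=
  (extDeriv (localForm α x) (extChartAt (𝓡 n) x x)).compContinuousLinearMap
    (mfderiv (𝓡 n) (𝓡 n) (extChartAt (𝓡 n) x) x)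

/-- Contraction of a field of alternating forms with a vector field (inserted in the first slot). -/
def contractAt {k : ℕ} (X : ∀ x : M, TangentSpace (𝓡 n) x)
    (α : FormField n M (k + 1)) (x : M) :
    TangentSpace (𝓡 n) x [⋀^Fin k]→L[ℝ] ℝ :=
  ContinuousAlternatingMap.curryLeft
    (show EuclideanSpace ℝ (Fin n) [⋀^Fin (k + 1)]→L[ℝ] ℝ from α x) (X x)

lemma eventually_overlap {x₀ x₁ : M} {y : EuclideanSpace ℝ (Fin n)}
    (hy : y ∈ (extChartAt (𝓡 n) x₀).target)
    (hy' : (extChartAt (𝓡 n) x₀).symm y ∈ (extChartAt (𝓡 n) x₁).source) :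
    ∀ᶠ z in 𝓝 y, z ∈ (extChartAt (𝓡 n) x₀).target ∧
      (extChartAt (𝓡 n) x₀).symm z ∈ (extChartAt (𝓡 n) x₁).source := by
  have hc : ContinuousAt (extChartAt (𝓡 n) x₀).symm y :=
    (continuousOn_extChartAt_symm x₀).continuousAt ((isOpen_extChartAt_target x₀).mem_nhds hy)
  filter_upwards [hc ((isOpen_extChartAt_source x₁).mem_nhds hy'),
    (isOpen_extChartAt_target x₀).mem_nhds hy] with z hz hz'
  exact ⟨hz', hz⟩

/-- The product `f s` of a function (`0`-form) `f` and a field `s` of `k`-forms. -/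
def mulField {k : ℕ} (f : FormField n M 0) (s : FormField n M k) : FormField n M k :=
  fun x => f x 0 • s x

lemma mulField_mem {k : ℕ} {f : FormField n M 0} {s : FormField n M k}
    (hf : f ∈ forms n M 0) (hs : s ∈ forms n M k) : mulField f s ∈ forms n M k := by
  intro x₀
  have h : localForm (mulField f s) x₀ = fun y => localForm f x₀ y 0 • localForm s x₀ y := by
    funext y
    have h0 : localForm f x₀ y 0 = f ((extChartAt (𝓡 n) x₀).symm y) 0 :=
      congrArg (f ((extChartAt (𝓡 n) x₀).symm y)) (Subsingleton.elim _ _)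
    rw [h0]
    rfl
  rw [h]
  exact ((ContinuousAlternatingMap.apply ℝ (EuclideanSpace ℝ (Fin n)) ℝ
    (0 : Fin 0 → EuclideanSpace ℝ (Fin n))).contDiff.comp_contDiffOn (hf x₀)).smul (hs x₀)

section calculus

variable [IsManifold (𝓡 n) ∞ M]

lemma mdiff_symm {x₀ : M} {y : EuclideanSpace ℝ (Fin n)}
    (hy : y ∈ (extChartAt (𝓡 n) x₀).target) :
    MDifferentiableAt (𝓡 n) (𝓡 n) (extChartAt (𝓡 n) x₀).symm y := by
  have : IsManifold (𝓡 n) 1 M := IsManifold.of_le (n := ∞) (by norm_cast)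
  exact (mdifferentiableOn_extChartAt_symm y hy).mdifferentiableAt
    ((isOpen_extChartAt_target x₀).mem_nhds hy)

lemma mdiff_chart {x₀ p : M} (hp : p ∈ (extChartAt (𝓡 n) x₀).source) :
    MDifferentiableAt (𝓡 n) (𝓡 n) (extChartAt (𝓡 n) x₀) p := by
  have : IsManifold (𝓡 n) 1 M := IsManifold.of_le (n := ∞) (by norm_cast)
  exact mdifferentiableAt_extChartAt (by simpa using hp)

/-- Transition map from the chart at `x₀` to the chart at `x₁`. -/
def transMap (x₀ x₁ : M) (y : EuclideanSpace ℝ (Fin n)) : EuclideanSpace ℝ (Fin n) :=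
  extChartAt (𝓡 n) x₁ ((extChartAt (𝓡 n) x₀).symm y)

lemma transMap_contDiffAt {x₀ x₁ : M} {y : EuclideanSpace ℝ (Fin n)}
    (hy : y ∈ (extChartAt (𝓡 n) x₀).target)
    (hy' : (extChartAt (𝓡 n) x₀).symm y ∈ (extChartAt (𝓡 n) x₁).source) :
    ContDiffAt ℝ ∞ (transMap x₀ x₁) y := by
  have := contDiffWithinAt_ext_coord_change (I := 𝓡 n) (n := ∞) x₁ x₀ (y := y)
    (by simp [PartialEquiv.trans_source] at hy hy' ⊢; exact ⟨hy, hy'⟩)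
  have h2 : ContDiffWithinAt ℝ ∞ (transMap x₀ x₁) (Set.range (𝓡 n)) y := this
  simpa [contDiffWithinAt_univ] using h2

lemma fderiv_transMap {x₀ x₁ : M} {y : EuclideanSpace ℝ (Fin n)}
    (hy : y ∈ (extChartAt (𝓡 n) x₀).target)
    (hy' : (extChartAt (𝓡 n) x₀).symm y ∈ (extChartAt (𝓡 n) x₁).source) :
    fderiv ℝ (transMap x₀ x₁) y =
      (mfderiv (𝓡 n) (𝓡 n) (extChartAt (𝓡 n) x₁) ((extChartAt (𝓡 n) x₀).symm y)).comp
        (mfderiv (𝓡 n) (𝓡 n) (extChartAt (𝓡 n) x₀).symm y) := by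
  rw [← mfderiv_eq_fderiv]
  exact mfderiv_comp y (mdiff_chart hy') (mdiff_symm hy)

/-- The inverse chart at `x₁` composed with the transition map is the inverse chart at `x₀`. -/
lemma mfderiv_symm_comp {x₀ x₁ : M} {y : EuclideanSpace ℝ (Fin n)}
    (hy : y ∈ (extChartAt (𝓡 n) x₀).target)
    (hy' : (extChartAt (𝓡 n) x₀).symm y ∈ (extChartAt (𝓡 n) x₁).source) :
    (mfderiv (𝓡 n) (𝓡 n) (extChartAt (𝓡 n) x₁).symm (transMap x₀ x₁ y)).comp
      (fderiv ℝ (transMap x₀ x₁) y) =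
    mfderiv (𝓡 n) (𝓡 n) (extChartAt (𝓡 n) x₀).symm y := by
  have hT : transMap x₀ x₁ y ∈ (extChartAt (𝓡 n) x₁).target :=
    (extChartAt (𝓡 n) x₁).map_source hy'
  have hd : MDifferentiableAt (𝓡 n) (𝓡 n) (transMap x₀ x₁) y :=
    ((transMap_contDiffAt hy hy').differentiableAt (by simp)).mdifferentiableAt
  have h0 : fderiv ℝ (transMap x₀ x₁) y = mfderiv (𝓡 n) (𝓡 n) (transMap x₀ x₁) y :=
    mfderiv_eq_fderiv.symm
  refine (congrArg (ContinuousLinearMap.comp _) h0).trans ?_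
  refine (mfderiv_comp y (mdiff_symm hT) hd).symm.trans ?_
  apply Filter.EventuallyEq.mfderiv_eq
  have hc : ContinuousAt (extChartAt (𝓡 n) x₀).symm y :=
    (continuousOn_extChartAt_symm x₀).continuousAt ((isOpen_extChartAt_target x₀).mem_nhds hy)
  filter_upwards [hc ((isOpen_extChartAt_source x₁).mem_nhds hy')] with z hz
  exact (extChartAt (𝓡 n) x₁).left_inv hz

/-- Change of chart for the expressions of a form. -/
lemma localForm_eq_pullback {k : ℕ} (α : FormField n M k)
    {x₀ x₁ : M} {y : EuclideanSpace ℝ (Fin n)}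
    (hy : y ∈ (extChartAt (𝓡 n) x₀).target)
    (hy' : (extChartAt (𝓡 n) x₀).symm y ∈ (extChartAt (𝓡 n) x₁).source) :
    localForm α x₀ y = (localForm α x₁ (transMap x₀ x₁ y)).compContinuousLinearMap
      (fderiv ℝ (transMap x₀ x₁) y) := by
  have h := mfderiv_symm_comp hy hy'
  have hp : (extChartAt (𝓡 n) x₁).symm (transMap x₀ x₁ y) = (extChartAt (𝓡 n) x₀).symm y :=
    (extChartAt (𝓡 n) x₁).left_inv hy'
  unfold localForm
  rw [← h, hp]
  rfl

/-- In every chart, the exterior derivative is the usual one. -/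
lemma localForm_extDerivAt {k : ℕ} {α : FormField n M k}
    (hα : α ∈ forms n M k) {x₀ : M} {y : EuclideanSpace ℝ (Fin n)}
    (hy : y ∈ (extChartAt (𝓡 n) x₀).target) :
    localForm (extDerivAt α) x₀ y = extDeriv (localForm α x₀) y := by
  set p := (extChartAt (𝓡 n) x₀).symm y with hp
  have hy' : (extChartAt (𝓡 n) x₀).symm y ∈ (extChartAt (𝓡 n) p).source :=
    mem_extChartAt_source p
  have hT : transMap x₀ p y ∈ (extChartAt (𝓡 n) p).target :=
    (extChartAt (𝓡 n) p).map_source hy'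
  have h1 : extDeriv (localForm α x₀) y =
      (extDeriv (localForm α p) (transMap x₀ p y)).compContinuousLinearMap
        (fderiv ℝ (transMap x₀ p) y) := by
    rw [← extDeriv_pullback (r := ∞) _ (transMap_contDiffAt hy hy') (by simp; exact ENat.LEInfty.out)]
    · apply Filter.EventuallyEq.extDeriv_eq
      filter_upwards [eventually_overlap hy hy'] with z hz
      exact localForm_eq_pullback α hz.1 hz.2
    · exact ((hα p).contDiffAt ((isOpen_extChartAt_target p).mem_nhds hT)).differentiableAt
        (by simp)
  rw [h1, fderiv_transMap hy hy']
  rfl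

lemma extDeriv_contDiffOn {k : ℕ}
    {f : EuclideanSpace ℝ (Fin n) → EuclideanSpace ℝ (Fin n) [⋀^Fin k]→L[ℝ] ℝ}
    {s : Set (EuclideanSpace ℝ (Fin n))} (hs : IsOpen s) (hf : ContDiffOn ℝ ∞ f s) :
    ContDiffOn ℝ ∞ (extDeriv f) s :=
  (ContinuousAlternatingMap.alternatizeUncurryFinCLM ℝ (EuclideanSpace ℝ (Fin n)) ℝ).contDiff.comp_contDiffOn
    (hf.fderiv_of_isOpen hs (by simp))

lemma extDerivAt_mem {k : ℕ} {α : FormField n M k}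
    (hα : α ∈ forms n M k) : extDerivAt α ∈ forms n M (k + 1) := fun x₀ =>
  (extDeriv_contDiffOn (isOpen_extChartAt_target x₀) (hα x₀)).congr
    fun _ hy => localForm_extDerivAt hα hy

lemma mfderiv_symm_localField (X : ∀ x : M, TangentSpace (𝓡 n) x) {x₀ : M}
    {y : EuclideanSpace ℝ (Fin n)} (hy : y ∈ (extChartAt (𝓡 n) x₀).target) :
    mfderiv (𝓡 n) (𝓡 n) (extChartAt (𝓡 n) x₀).symm y (localField X x₀ y) =
      X ((extChartAt (𝓡 n) x₀).symm y) := by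
  have : IsManifold (𝓡 n) 1 M := IsManifold.of_le (n := ∞) (by norm_cast)
  have h := mfderivWithin_extChartAt_symm_comp_mfderiv_extChartAt (I := 𝓡 n) hy
  have h2 := congrArg (fun L => L (X ((extChartAt (𝓡 n) x₀).symm y))) h
  rw [modelWithCornersSelf_coe, Set.range_id, mfderivWithin_univ] at h2
  exact h2

lemma localForm_contractAt {k : ℕ} (X : ∀ x : M, TangentSpace (𝓡 n) x)
    (α : FormField n M (k + 1)) {x₀ : M}
    {y : EuclideanSpace ℝ (Fin n)} (hy : y ∈ (extChartAt (𝓡 n) x₀).target) :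
    localForm (contractAt X α) x₀ y = (localForm α x₀ y).curryLeft (localField X x₀ y) := by
  refine Eq.trans ?_ (ContinuousAlternatingMap.curryLeft_compContinuousLinearMap
    (E := EuclideanSpace ℝ (Fin n))
    (show EuclideanSpace ℝ (Fin n) [⋀^Fin (k + 1)]→L[ℝ] ℝ from α ((extChartAt (𝓡 n) x₀).symm y))
    (mfderiv (𝓡 n) (𝓡 n) (extChartAt (𝓡 n) x₀).symm y) (localField X x₀ y)).symm
  exact congrArg (fun v => (ContinuousAlternatingMap.curryLeft
    (show EuclideanSpace ℝ (Fin n) [⋀^Fin (k + 1)]→L[ℝ] ℝ from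
      α ((extChartAt (𝓡 n) x₀).symm y)) v).compContinuousLinearMap
    (mfderiv (𝓡 n) (𝓡 n) (extChartAt (𝓡 n) x₀).symm y)) (mfderiv_symm_localField X hy).symm

lemma localField_contDiffOn (X : ∀ x : M, TangentSpace (𝓡 n) x)
    (hX : ContMDiff (𝓡 n) (𝓡 n).tangent ∞ (fun x => (⟨x, X x⟩ : TangentBundle (𝓡 n) M))) (x₀ : M) :
    ContDiffOn ℝ ∞ (localField X x₀) (extChartAt (𝓡 n) x₀).target := by
  have : IsManifold (𝓡 n) 1 M := IsManifold.of_le (n := ∞) (by norm_cast)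
  rw [← contMDiffOn_iff_contDiffOn]
  have h1 := ((trivializationAt (EuclideanSpace ℝ (Fin n)) (TangentSpace (𝓡 n)) x₀).contMDiffOn_section_baseSet_iff
    (IB := 𝓡 n) (n := ∞) (s := X)).1 hX.contMDiffOn
  have h2 := h1.comp (contMDiffOn_extChartAt_symm (I := 𝓡 n) (n := ∞) x₀)
    (fun y hy => by simpa using (extChartAt (𝓡 n) x₀).map_target hy)
  refine h2.congr fun y hy => ?_
  have hs : (extChartAt (𝓡 n) x₀).symm y ∈ (chartAt (EuclideanSpace ℝ (Fin n)) x₀).source := by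
    simpa using (extChartAt (𝓡 n) x₀).map_target hy
  have h3 := TangentBundle.continuousLinearMapAt_trivializationAt (I := 𝓡 n) hs
  refine (congrArg (fun L => L (X ((extChartAt (𝓡 n) x₀).symm y))) h3).symm.trans ?_
  exact Bundle.Trivialization.continuousLinearMapAt_apply_of_mem (R := ℝ)
    (trivializationAt (EuclideanSpace ℝ (Fin n)) (TangentSpace (𝓡 n)) x₀) (by simpa using hs) _

lemma contractAt_mem {k : ℕ} (X : Cₛ^∞⟮𝓡 n; EuclideanSpace ℝ (Fin n),
      (TangentSpace (𝓡 n) : M → Type _)⟯)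
    {α : FormField n M (k + 1)}
    (hα : α ∈ forms n M (k + 1)) : contractAt X α ∈ forms n M k := by
  intro x₀
  refine ContDiffOn.congr ?_ fun y hy => localForm_contractAt X α hy
  have hL : ContDiff ℝ ∞ (fun a : EuclideanSpace ℝ (Fin n) [⋀^Fin (k + 1)]→L[ℝ] ℝ =>
      a.curryLeft) := by
    refine IsBoundedLinearMap.contDiff ⟨⟨fun _ _ => rfl, fun _ _ => rfl⟩, 1, one_pos, fun a => ?_⟩
    rw [one_mul]
    exact a.norm_curryLeft.le
  have h1 := hL.comp_contDiffOn (hα x₀)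
  exact h1.clm_apply (localField_contDiffOn X X.contMDiff x₀)

end calculus

variable [IsManifold (𝓡 n) ∞ M]

/-- The exterior derivative `d` on `C^∞` forms. -/
def extD (k : ℕ) : forms n M k →ₗ[ℝ] forms n M (k + 1) where
  toFun u := ⟨extDerivAt u.1, extDerivAt_mem u.2⟩
  map_add' u v := by
    have hd (w : forms n M k) (x : M) :
        DifferentiableAt ℝ (localForm w.1 x) (extChartAt (𝓡 n) x x) :=
      ((w.2 x).contDiffAt (extChartAt_target_mem_nhds x)).differentiableAt (by simp)
    refine Subtype.ext (funext fun x => ?_)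
    change (extDeriv (localForm u.1 x + localForm v.1 x) _).compContinuousLinearMap _ = _
    rw [extDeriv_add (hd u x) (hd v x)]
    rfl
  map_smul' c u := by
    refine Subtype.ext (funext fun x => ?_)
    change (extDeriv (c • localForm u.1 x) _).compContinuousLinearMap _ = _
    rw [extDeriv_smul]
    rfl

/-- A `C^∞` vector field on `M`. -/
abbrev Field (n : ℕ) (M : Type*) [TopologicalSpace M]
    [ChartedSpace (EuclideanSpace ℝ (Fin n)) M] [IsManifold (𝓡 n) ∞ M] : Type _ :=
  Cₛ^∞⟮𝓡 n; EuclideanSpace ℝ (Fin n), (TangentSpace (𝓡 n) : M → Type _)⟯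

/-- The contraction `i_X` of forms of positive degree with the vector field `X`. -/
def iota (X : Field n M) (k : ℕ) : forms n M (k + 1) →ₗ[ℝ] forms n M k where
  toFun u := ⟨contractAt X u.1, contractAt_mem X u.2⟩
  map_add' _ _ := rfl
  map_smul' _ _ := rfl

lemma iota_iota (X : Field n M) (k : ℕ) (u : forms n M (k + 2)) :
    iota X k (iota X (k + 1) u) = 0 := by
  refine Subtype.ext (funext fun x => ?_)
  exact ContinuousAlternatingMap.curryLeft_same (E := EuclideanSpace ℝ (Fin n))
    (show EuclideanSpace ℝ (Fin n) [⋀^Fin (k + 2)]→L[ℝ] ℝ from u.1 x) (X x)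

/-- The space `Λ_X^k` of the `k`-forms `u` with `i_X u = 0`; every function belongs to `Λ_X^0`. -/
def lambdaX (X : Field n M) : (k : ℕ) → Submodule ℝ (forms n M k)
  | 0 => ⊤
  | k + 1 => LinearMap.ker (iota X k)

/-- The Lie derivative `∇_X^k = d i_X + i_X d` on `k`-forms; on functions it is `i_X d`. -/
def lieD (X : Field n M) : (k : ℕ) → forms n M k →ₗ[ℝ] forms n M k
  | 0 => iota X 0 ∘ₗ extD 0
  | k + 1 => extD k ∘ₗ iota X k + iota X (k + 1) ∘ₗ extD (k + 1)

/-- `i_X : Λ^{k+1} → Λ^k` takes its values in `Λ_X^k`. -/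
def iotaX (X : Field n M) (k : ℕ) : forms n M (k + 1) →ₗ[ℝ] lambdaX X k :=
  (iota X k).codRestrict (lambdaX X k) fun u => match k, u with
    | 0, _ => trivial
    | k + 1, u => iota_iota X k u

lemma lieD_of_mem (X : Field n M) {k : ℕ} {u : forms n M k} (hu : u ∈ lambdaX X k) :
    lieD X k u = iota X k (extD k u) := by
  cases k with
  | zero => rfl
  | succ k =>
    have h : iota X k u = 0 := hu
    simp [lieD, h]

/-- `∇_X^{k,*}`: the Lie derivative as an operator on `Λ_X^k`. -/
def lieDX (X : Field n M) (k : ℕ) : lambdaX X k →ₗ[ℝ] lambdaX X k :=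
  (lieD X k).restrict fun u hu => by
    rw [lieD_of_mem X hu]
    exact (iotaX X k (extD k u)).2

/-- `Im(∇_X^{k,*})` is contained in `Im(i_X)`. -/
lemma range_lieDX_le (X : Field n M) (k : ℕ) :
    LinearMap.range (lieDX X k) ≤ LinearMap.range (iotaX X k) := by
  rintro _ ⟨u, rfl⟩
  exact ⟨extD k u.1, Subtype.ext (lieD_of_mem X u.2).symm⟩

/-- `Coker(∇_X^k) = Λ^k / ∇_X^k(Λ^k)`. -/
abbrev Coker (X : Field n M) (k : ℕ) : Type _ := forms n M k ⧸ LinearMap.range (lieD X k)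

/-- `Coker(∇_X^{k,*}) = Λ_X^k / ∇_X^k(Λ_X^k)`. -/
abbrev CokerX (X : Field n M) (k : ℕ) : Type _ := lambdaX X k ⧸ LinearMap.range (lieDX X k)

/-- `C_X^k = Im(i_X) / Im(∇_X^{k,*})`, as a subspace of `Coker(∇_X^{k,*})`. -/
def C (X : Field n M) (k : ℕ) : Submodule ℝ (CokerX X k) :=
  (LinearMap.range (iotaX X k)).map (LinearMap.range (lieDX X k)).mkQ

variable (n M) in
/-- The space `Z^k` of closed `k`-forms. -/
def closedForms (k : ℕ) : Submodule ℝ (forms n M k) := LinearMap.ker (extD k)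

/-- `d(Λ_X^{k-1})`, a subspace of `Λ^k` (zero for `k = 0`). -/
def exactX (X : Field n M) : (k : ℕ) → Submodule ℝ (forms n M k)
  | 0 => ⊥
  | k + 1 => (lambdaX X k).map (extD k)

/-- `H_X^k = Z^k / d(Λ_X^{k-1})`. -/
abbrev H (X : Field n M) (k : ℕ) : Type _ :=
  closedForms n M k ⧸ (exactX X k).submoduleOf (closedForms n M k)

/-- The zeros (critical points) of `X`. -/
def zeros (X : Field n M) : Set M := {x | X x = 0}

/-- The space of the functions which, near `x`, are of the form `i_X u` for a smooth `1`-form `u`,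
that is, whose germs at `x` lie in the ideal generated by the components of `X`. -/
def localIdeal (X : Field n M) (x : M) : Submodule ℝ (forms n M 0) where
  carrier := {f | ∃ u : forms n M 1, ∀ᶠ y in 𝓝 x, (iota X 0 u).1 y = f.1 y}
  add_mem' := by
    rintro f g ⟨u, hu⟩ ⟨v, hv⟩
    refine ⟨u + v, ?_⟩
    filter_upwards [hu, hv] with y h1 h2
    rw [map_add]
    exact congrArg₂ (· + ·) h1 h2
  zero_mem' := ⟨0, by simp⟩
  smul_mem' := by
    rintro c f ⟨u, hu⟩
    refine ⟨c • u, ?_⟩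
    filter_upwards [hu] with y h1
    rw [map_smul]
    exact congrArg (c • ·) h1

/-- The local algebra of `X` at `x`: smooth functions near `x` modulo the ideal generated by the
components of `X`. (On a Hausdorff manifold every germ of a smooth function or form extends to all
of `M`, so global functions and forms may be used.) Its dimension is the Milnor index. -/
abbrev LocalAlgebra (X : Field n M) (x : M) : Type _ := forms n M 0 ⧸ localIdeal X x

/-- `X` is of finite type: its zeros are isolated and have finite Milnor index. -/
def IsFiniteType (X : Field n M) : Prop :=
  ∀ x ∈ zeros X, (∀ᶠ y in 𝓝[≠] x, y ∉ zeros X) ∧ FiniteDimensional ℝ (LocalAlgebra X x)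

/-- A zero `x` of `X` is non-degenerate: the Jacobian matrix of `X` at `x`, in the chart centred
at `x`, is invertible. -/
def IsNondegenerateAt (X : Field n M) (x : M) : Prop :=
  Function.Bijective (fderiv ℝ (localField X x) (extChartAt (𝓡 n) x x))

/-- The product `f s` of a smooth function (`0`-form) `f` and a smooth `k`-form `s`. -/
def mulForm {k : ℕ} (f : forms n M 0) (s : forms n M k) : forms n M k :=
  ⟨mulField f.1 s.1, mulField_mem f.2 s.2⟩

end Novikov

end

/-! Nearly everything reduces to exactness of contraction: when is each `u` in `Λ_X^k` of the form
`i_X v`? Since `i_X` is linear over smooth functions, a partition of unity makes this a local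
question, and there are three local cases.

Where `X ≠ 0`, choose a covector `θ` with `θ(X) ≠ 0`; then `v = θ(X)⁻¹ θ ∧ u` works
(`isContractionNear_of_ne`). Near a non-degenerate zero `a`, write `X(y) = A(y)(y - a)` with `A(y)`
invertible. Transport by `A` replaces `X` by the radial field, whose contraction is inverted by
integrating Euler's formula along rays (`isContractionNear_of_nondegenerate`). In degree 0 the only
obstruction is the value at the zero.

Near a zero of finite Milnor index, in degree `n - 1 > 0`, the powers of a coordinate `l_i` are
linearly dependent in the local algebra, so `l_i^{r_i} q_i = θ_i(X)` with `q_i` a unit. For two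
coordinates, `v_i = q_i⁻¹ θ_i ∧ w` satisfies `i_X v_i = l_i^{r_i} w`. The top-degree forms
`l_1^{r_1} v_0` and `l_0^{r_0} v_1` have the same contraction, hence agree. By smooth division `v_0
= l_0^{r_0} g`, and then `i_X g = w` (`isContractionNear_of_pow_coordinates`).

The top-degree statements follow because an `n`-form killed by a nonzero vector vanishes and, for `n
≥ 1`, the complement of isolated zeros is dense. Thus `i_X` is injective on `n`-forms, and `∇_X w =
i_X dw` on `Λ_X^{n-1}` gives `H_X^n ≅ C_X^{n-1}`. On `n`-forms `∇_X = d i_X`, so exactness gives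
`H_X^n = Coker(∇_X^n)`. With an invariant volume form, `∇_X(fσ) = (∇_X f)σ`; in dimension one such a
field cannot have isolated zeros. The codimension is counted by evaluating functions at finite sets
of zeros. -/

noncomputable section

namespace Novikov

/-! ### Parameter integrals, density arguments and smooth division. -/

section parametric

universe v

variable {E : Type v} [NormedAddCommGroup E] [NormedSpace ℝ E]

lemma contDiff_smul_of_tsupport {F : Type*} [NormedAddCommGroup F] [NormedSpace ℝ F] {U : Set E}
    (hU : IsOpen U) {χ : E → ℝ} (hχ : ContDiff ℝ ∞ χ) (hs : tsupport χ ⊆ U) {f : E → F}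
    (hf : ContDiffOn ℝ ∞ f U) : ContDiff ℝ ∞ fun y => χ y • f y := by
  rw [contDiff_iff_contDiffAt]
  intro y
  by_cases hy : y ∈ tsupport χ
  · exact hχ.contDiffAt.smul (hf.contDiffAt (hU.mem_nhds (hs hy)))
  · refine (contDiffAt_const (c := (0 : F))).congr_of_eventuallyEq ?_
    filter_upwards [(isClosed_tsupport χ).isOpen_compl.mem_nhds hy] with z hz
    rw [image_eq_zero_of_notMem_tsupport hz, zero_smul]

lemma eq_zero_of_line {F : Type*} [TopologicalSpace F] [T2Space F] [Zero F] {f : E → F} {y e : E}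
    (hf : ContinuousAt f y) (h : ∀ᶠ t : ℝ in 𝓝[≠] 0, f (y + t • e) = 0) : f y = 0 := by
  have h1 : Filter.Tendsto (fun t : ℝ => f (y + t • e)) (𝓝[≠] 0) (𝓝 (f y)) := by
    have h2 : Filter.Tendsto (fun t : ℝ => y + t • e) (𝓝[≠] 0) (𝓝 y) := by
      have : Continuous fun t : ℝ => y + t • e := by fun_prop
      simpa using (this.tendsto 0).mono_left nhdsWithin_le_nhds
    exact hf.tendsto.comp h2
  exact tendsto_nhds_unique (h1.congr' h) tendsto_const_nhds

/-- A continuous function vanishing off an affine hyperplane vanishes. -/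
lemma eq_zero_of_affine {F : Type*} [TopologicalSpace F] [T2Space F] [Zero F] {f : E → F}
    (l : E →L[ℝ] ℝ) {y e : E} (he : l e = 1) (a : E) (hf : ContinuousAt f y)
    (h : ∀ᶠ z in 𝓝 y, l (z - a) ≠ 0 → f z = 0) : f y = 0 := by
  by_cases hy : l (y - a) = 0
  · refine eq_zero_of_line (e := e) hf ?_
    have : Filter.Tendsto (fun t : ℝ => y + t • e) (𝓝[≠] 0) (𝓝 y) := by
      have : Continuous fun t : ℝ => y + t • e := by fun_prop
      simpa using (this.tendsto 0).mono_left nhdsWithin_le_nhds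
    filter_upwards [this.eventually h, self_mem_nhdsWithin] with t ht ht0
    apply ht
    rw [add_sub_right_comm, map_add, hy, map_smul, he]
    simpa using ht0
  · exact h.self_of_nhds hy

variable [FiniteDimensional ℝ E]

lemma hasFDerivAt_intervalIntegral_param {F : Type v} [NormedAddCommGroup F] [NormedSpace ℝ F]
    {f : E → ℝ → F} (hf : ContDiff ℝ 1 (Function.uncurry f)) (x₀ : E) :
    HasFDerivAt (fun x => ∫ t in (0 : ℝ)..1, f x t)
      (∫ t in (0 : ℝ)..1,
        (fderiv ℝ (Function.uncurry f) (x₀, t)).comp (ContinuousLinearMap.inl ℝ E ℝ)) x₀ := by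
  have hc : Continuous (Function.uncurry f) := hf.continuous
  have hc' : Continuous fun p : E × ℝ =>
      (fderiv ℝ (Function.uncurry f) p).comp (ContinuousLinearMap.inl ℝ E ℝ) :=
    (hf.continuous_fderiv (by simp)).clm_comp continuous_const
  obtain ⟨B, hB⟩ := ((isCompact_closedBall x₀ 1).prod (isCompact_Icc (a := (0 : ℝ)) (b := 1))).exists_bound_of_continuousOn
    hc'.continuousOn
  refine intervalIntegral.hasFDerivAt_integral_of_dominated_of_fderiv_le (s := Metric.closedBall x₀ 1)
    (F := f) (F' := fun x t =>
      (fderiv ℝ (Function.uncurry f) (x, t)).comp (ContinuousLinearMap.inl ℝ E ℝ))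
    (bound := fun _ => B) (Metric.closedBall_mem_nhds x₀ one_pos) ?_ ?_ ?_ ?_ ?_ ?_
  · exact Filter.Eventually.of_forall fun x =>
      (hc.comp (Continuous.prodMk_right x)).aestronglyMeasurable
  · exact (hc.comp (Continuous.prodMk_right x₀)).intervalIntegrable _ _
  · exact (hc'.comp (Continuous.prodMk_right x₀)).aestronglyMeasurable
  · refine Filter.Eventually.of_forall fun t ht x hx => hB (x, t) ⟨hx, ?_⟩
    rw [Set.uIoc_of_le zero_le_one] at ht
    exact ⟨ht.1.le, ht.2⟩
  · exact intervalIntegrable_const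
  · refine Filter.Eventually.of_forall fun t _ x _ => ?_
    exact (hf.differentiable (by simp) (x, t)).hasFDerivAt.comp (f := fun e : E => (e, t)) x
      (hasFDerivAt_prodMk_left x t)

/-- Integrals over `[0, 1]` depend smoothly on parameters. -/
lemma contDiff_intervalIntegral_param {F : Type v} [NormedAddCommGroup F] [NormedSpace ℝ F]
    {f : E → ℝ → F} (hf : ContDiff ℝ ∞ (Function.uncurry f)) :
    ContDiff ℝ ∞ (fun x => ∫ t in (0 : ℝ)..1, f x t) := by
  rw [contDiff_infty]
  intro m
  -- The derivative is again such an integral, with values in `E →L[ℝ] F`; this is why `E` and `F`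
  -- share a universe.
  induction m generalizing F with
  | zero =>
    exact contDiff_zero.2 (intervalIntegral.continuous_parametric_intervalIntegral_of_continuous'
      hf.continuous 0 1)
  | succ m ih =>
    refine contDiff_succ_iff_hasFDerivAt.2 ⟨_, ?_, fun x =>
      hasFDerivAt_intervalIntegral_param (hf.of_le (by norm_cast)) x⟩
    exact ih (f := fun x t =>
      (fderiv ℝ (Function.uncurry f) (x, t)).comp (ContinuousLinearMap.inl ℝ E ℝ))
      ((hf.fderiv_right (m := ∞) (by simp)).clm_comp contDiff_const)

/-- Cutting off a function on a neighbourhood. -/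
lemma exists_cutoff {U : Set E} {a : E} (hU : U ∈ 𝓝 a) :
    ∃ χ : E → ℝ, ContDiff ℝ ∞ χ ∧ HasCompactSupport χ ∧ tsupport χ ⊆ U ∧ χ =ᶠ[𝓝 a] 1 := by
  obtain ⟨ε, hε, hεU⟩ := Metric.nhds_basis_closedBall.mem_iff.1 hU
  let b : ContDiffBump a := ⟨ε / 2, ε, by positivity, by linarith⟩
  exact ⟨b, b.contDiff, b.hasCompactSupport, b.tsupport_eq.trans_subset hεU, b.eventuallyEq_one⟩

/-- Hadamard's lemma along the direction `e`. -/
lemma exists_eq_smul_of_vanish {F : Type v} [NormedAddCommGroup F] [NormedSpace ℝ F]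
    [CompleteSpace F] {f : E → F} (hf : ContDiff ℝ ∞ f) (l : E →L[ℝ] ℝ) {e : E} (he : l e = 1) (a : E)
    (h0 : ∀ y, l (y - a) = 0 → f y = 0) :
    ∃ g : E → F, ContDiff ℝ ∞ g ∧ ∀ y, f y = l (y - a) • g y := by
  -- The segment runs along `e` from the projection of `y` to the hyperplane `l (· - a) = 0`, at `t
  -- = 0`, to `y` itself, at `t = 1`.
  let G : E → ℝ → F := fun y t => fderiv ℝ f (y + ((t - 1) * l (y - a)) • e) e
  have hG : ContDiff ℝ ∞ (Function.uncurry G) := by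
    refine ((hf.fderiv_right (m := ∞) (by simp)).comp ?_).clm_apply contDiff_const
    fun_prop
  refine ⟨fun y => ∫ t in (0 : ℝ)..1, G y t, contDiff_intervalIntegral_param hG, fun y => ?_⟩
  have hd : ∀ t : ℝ, HasDerivAt (fun t : ℝ => f (y + ((t - 1) * l (y - a)) • e))
      (l (y - a) • G y t) t := by
    intro t
    have h1 : HasDerivAt (fun t : ℝ => y + ((t - 1) * l (y - a)) • e) (l (y - a) • e) t := by
      have := ((((hasDerivAt_id t).sub_const 1).mul_const (l (y - a))).smul_const e).const_add y
      simpa using this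
    have h2 := ((hf.differentiable (by simp)) (y + ((t - 1) * l (y - a)) • e)).hasFDerivAt.comp_hasDerivAt t h1
    simpa [G, Function.comp_def] using h2
  have hi := intervalIntegral.integral_eq_sub_of_hasDerivAt (a := 0) (b := 1)
    (fun t _ => hd t) (by
      refine Continuous.intervalIntegrable ?_ _ _
      exact continuous_const.smul (hG.continuous.comp (Continuous.prodMk_right y)))
  rw [intervalIntegral.integral_smul] at hi
  rw [hi, h0 (y + ((0 - 1) * l (y - a)) • e) (by
    rw [add_sub_right_comm, map_add, map_smul, he]; simp)]
  simp

/-- Smooth division: two powers of independent coordinates are coprime. -/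
lemma exists_eq_pow_smul {F : Type v} [NormedAddCommGroup F] [NormedSpace ℝ F]
    [CompleteSpace F] (l₀ l₁ : E →L[ℝ] ℝ) {e₀ e₁ : E} (h00 : l₀ e₀ = 1) (h01 : l₀ e₁ = 0)
    (h11 : l₁ e₁ = 1) (a : E) (s r : ℕ) {f h : E → F} (hf : ContDiff ℝ ∞ f)
    (hh : ContDiff ℝ ∞ h)
    (heq : ∀ y, l₁ (y - a) ^ s • f y = l₀ (y - a) ^ r • h y) :
    ∃ g : E → F, ContDiff ℝ ∞ g ∧ ∀ y, f y = l₀ (y - a) ^ r • g y := by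
  induction r generalizing f with
  | zero => exact ⟨f, hf, fun y => by simp⟩
  | succ r ih =>
    -- On the hyperplane of `l₀` the relation reads `l₁ ^ s • f = 0`. The direction `e₁` stays in
    -- this hyperplane and makes `l₁` nonzero, so `f` vanishes there by continuity.
    obtain ⟨g₁, hg₁, hfg⟩ := exists_eq_smul_of_vanish hf l₀ h00 a (by
      intro y hy
      refine eq_zero_of_line (e := e₁) hf.continuous.continuousAt ?_
      have hev : ∀ᶠ t : ℝ in 𝓝[≠] 0, l₁ (y - a) + t ≠ 0 := by
        by_cases h : l₁ (y - a) = 0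
        · filter_upwards [self_mem_nhdsWithin] with t ht
          simpa [h] using ht
        · have : ContinuousAt (fun t : ℝ => l₁ (y - a) + t) 0 := by fun_prop
          exact (this.eventually_ne (by simpa using h)).filter_mono nhdsWithin_le_nhds
      filter_upwards [hev] with t ht
      have h1 := heq (y + t • e₁)
      have h2 : l₀ (y + t • e₁ - a) = 0 := by
        rw [add_sub_right_comm, map_add, hy, map_smul, h01]; simp
      have h3 : l₁ (y + t • e₁ - a) = l₁ (y - a) + t := by
        rw [add_sub_right_comm, map_add, map_smul, h11]; simp
      rw [h2, h3, zero_pow (Nat.succ_ne_zero r), zero_smul] at h1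
      exact (smul_eq_zero.1 h1).resolve_left (pow_ne_zero _ ht))
    -- One factor `l₀` cancels off the hyperplane, hence everywhere by continuity.
    obtain ⟨g, hg, hgg⟩ := ih hg₁ (by
      intro y
      rw [← sub_eq_zero]
      refine eq_zero_of_affine (f := fun y => l₁ (y - a) ^ s • g₁ y - l₀ (y - a) ^ r • h y) l₀ h00 a
        ?_ (Filter.Eventually.of_forall fun z hz => ?_)
      · have := hg₁.continuous
        have := hh.continuous
        fun_prop
      · have h1 := heq z
        rw [hfg z, pow_succ', mul_smul, smul_comm] at h1
        exact sub_eq_zero.2 (smul_right_injective F hz h1))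
    exact ⟨g, hg, fun y => by rw [hfg y, hgg y, smul_smul, pow_succ']⟩

end parametric

/-! ### Contraction and wedge product of alternating forms. -/

section algebra

variable {E : Type*} [NormedAddCommGroup E] [NormedSpace ℝ E]

/-- Contraction with a fixed vector as a continuous linear map. -/
def contractCLM (k : ℕ) (v : E) : (E [⋀^Fin (k + 1)]→L[ℝ] ℝ) →L[ℝ] (E [⋀^Fin k]→L[ℝ] ℝ) :=
  (ContinuousLinearMap.apply ℝ _ v).comp
    (ContinuousAlternatingMap.curryLeftLI (𝕜 := ℝ) (E := E) (F := ℝ)).toContinuousLinearMap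

@[simp] lemma contractCLM_apply {k : ℕ} (v : E) (u : E [⋀^Fin (k + 1)]→L[ℝ] ℝ) :
    contractCLM k v u = u.curryLeft v := rfl

/-- The contraction of `u` with `v` vanishes (no condition in degree `0`). -/
def Killed (v : E) : {k : ℕ} → (E [⋀^Fin k]→L[ℝ] ℝ) → Prop
  | 0, _ => True
  | _ + 1, u => u.curryLeft v = 0

lemma curryLeft_alternatizeUncurryFin_zero (f : E →L[ℝ] E [⋀^Fin 0]→L[ℝ] ℝ) (v : E) :
    (ContinuousAlternatingMap.alternatizeUncurryFin f).curryLeft v = f v := by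
  ext w
  simp only [ContinuousAlternatingMap.curryLeft_apply_apply,
    ContinuousAlternatingMap.alternatizeUncurryFin_apply]
  simp [Subsingleton.elim (Fin.removeNth 0 (Matrix.vecCons v w)) w]

/-- The summand of index 0 inserts `v` into the linear slot. In the others `v` remains the first
form argument, and the shift of the index by one changes the sign. This is the algebra behind
Cartan's formula. -/
lemma curryLeft_alternatizeUncurryFin {k : ℕ} (f : E →L[ℝ] E [⋀^Fin (k + 1)]→L[ℝ] ℝ) (v : E) :
    (ContinuousAlternatingMap.alternatizeUncurryFin f).curryLeft v =
      f v - ContinuousAlternatingMap.alternatizeUncurryFin ((contractCLM k v).comp f) := by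
  ext w
  simp only [ContinuousAlternatingMap.curryLeft_apply_apply,
    ContinuousAlternatingMap.alternatizeUncurryFin_apply, ContinuousAlternatingMap.sub_apply]
  rw [Fin.sum_univ_succ, sub_eq_add_neg, ← Finset.sum_neg_distrib]
  congr 1
  · simp [Matrix.vecCons]
  · refine Finset.sum_congr rfl fun i _ => ?_
    have h : Fin.removeNth i.succ (Matrix.vecCons v w) = Matrix.vecCons v (Fin.removeNth i w) :=
      by
      funext j
      cases j using Fin.cases with
      | zero => simp [Fin.removeNth, Matrix.vecCons]
      | succ j => simp [Fin.removeNth, Matrix.vecCons]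
    rw [h]
    simp [pow_succ]

/-- The wedge product of a linear form with an alternating form. -/
def wedge {k : ℕ} (θ : E →L[ℝ] ℝ) (u : E [⋀^Fin k]→L[ℝ] ℝ) : E [⋀^Fin (k + 1)]→L[ℝ] ℝ :=
  ContinuousAlternatingMap.alternatizeUncurryFin (θ.smulRight u)

/-- The antiderivation rule `i_v(θ ∧ u) = θ(v) u - θ ∧ i_v u` loses its last term. Wedging with `θ`
thus inverts contraction, up to the factor `θ v`. -/
lemma curryLeft_wedge {k : ℕ} (θ : E →L[ℝ] ℝ) {u : E [⋀^Fin k]→L[ℝ] ℝ} {v : E} (hu : Killed v u) :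
    (wedge θ u).curryLeft v = θ v • u := by
  cases k with
  | zero => simp [wedge, curryLeft_alternatizeUncurryFin_zero]
  | succ k =>
    have h : (contractCLM k v).comp (θ.smulRight u) = 0 := by
      ext w : 1
      have hu' : u.curryLeft v = 0 := hu
      simp [hu']
    rw [wedge, curryLeft_alternatizeUncurryFin, h]
    have h0 : ContinuousAlternatingMap.alternatizeUncurryFin (0 : E →L[ℝ] E [⋀^Fin k]→L[ℝ] ℝ) = 0 :=
      map_zero (ContinuousAlternatingMap.alternatizeUncurryFinCLM ℝ E ℝ)
    rw [h0]
    simp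

lemma contDiff_curryLeft (k : ℕ) :
    ContDiff ℝ ∞ fun a : E [⋀^Fin (k + 1)]→L[ℝ] ℝ => a.curryLeft := by
  have h' := LinearIsometry.contDiff (𝕜 := ℝ) (n := ∞) (E := E [⋀^Fin (k + 1)]→L[ℝ] ℝ)
    (F := E →L[ℝ] E [⋀^Fin k]→L[ℝ] ℝ) ContinuousAlternatingMap.curryLeftLI
  exact h'

lemma contDiff_alternatizeUncurryFin (k : ℕ) :
    ContDiff ℝ ∞ fun f : E →L[ℝ] E [⋀^Fin k]→L[ℝ] ℝ =>
      ContinuousAlternatingMap.alternatizeUncurryFin f := by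
  have h' := ContinuousLinearMap.contDiff (𝕜 := ℝ) (n := ∞) (E := E →L[ℝ] E [⋀^Fin k]→L[ℝ] ℝ)
    (F := E [⋀^Fin (k + 1)]→L[ℝ] ℝ) (ContinuousAlternatingMap.alternatizeUncurryFinCLM ℝ E ℝ)
  exact h'

lemma contDiffOn_wedge {G : Type*} [NormedAddCommGroup G] [NormedSpace ℝ G] {k : ℕ}
    {θ : G → E →L[ℝ] ℝ} {u : G → E [⋀^Fin k]→L[ℝ] ℝ} {s : Set G}
    (hθ : ContDiffOn ℝ ∞ θ s) (hu : ContDiffOn ℝ ∞ u s) :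
    ContDiffOn ℝ ∞ (fun y => wedge (θ y) (u y)) s :=
  (contDiff_alternatizeUncurryFin k).comp_contDiffOn (hθ.smulRight hu)

lemma contDiffOn_curryLeft {G : Type*} [NormedAddCommGroup G] [NormedSpace ℝ G] {k : ℕ}
    {X : G → E} {u : G → E [⋀^Fin (k + 1)]→L[ℝ] ℝ} {s : Set G}
    (hu : ContDiffOn ℝ ∞ u s) (hX : ContDiffOn ℝ ∞ X s) :
    ContDiffOn ℝ ∞ (fun y => (u y).curryLeft (X y)) s :=
  ((contDiff_curryLeft k).comp_contDiffOn hu).clm_apply hX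

lemma killed_smul {k : ℕ} (c : ℝ) {u : E [⋀^Fin k]→L[ℝ] ℝ} {v : E} (hu : Killed v u) :
    Killed v (c • u) := by
  cases k with
  | zero => trivial
  | succ k =>
    have hu' : u.curryLeft v = 0 := hu
    simp [Killed, hu']

lemma killed_zero {k : ℕ} (v : E) : Killed v (0 : E [⋀^Fin k]→L[ℝ] ℝ) := by
  cases k with
  | zero => trivial
  | succ k => simp [Killed]

lemma killed_smul_left {k : ℕ} (c : ℝ) {u : E [⋀^Fin k]→L[ℝ] ℝ} {v : E} (hu : Killed v u) :
    Killed (c • v) u := by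
  cases k with
  | zero => trivial
  | succ k =>
    have hu' : u.curryLeft v = 0 := hu
    simp [Killed, hu']

lemma killed_comp {k : ℕ} {F : Type*} [NormedAddCommGroup F] [NormedSpace ℝ F]
    {u : F [⋀^Fin k]→L[ℝ] ℝ} {v : E} {A : E →L[ℝ] F} (hu : Killed (A v) u) :
    Killed v (u.compContinuousLinearMap A) := by
  cases k with
  | zero => trivial
  | succ k =>
    have hu' : u.curryLeft (A v) = 0 := hu
    simp only [Killed, ContinuousAlternatingMap.curryLeft_compContinuousLinearMap, hu']
    rfl

/-- An alternating form depends smoothly on vectors. -/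
lemma contDiffOn_alternating_apply {G : Type*} [NormedAddCommGroup G] [NormedSpace ℝ G] {k : ℕ}
    {u : G → E [⋀^Fin k]→L[ℝ] ℝ} {s : Set G} (hu : ContDiffOn ℝ ∞ u s) {v : Fin k → G → E}
    (hv : ∀ i, ContDiffOn ℝ ∞ (v i) s) : ContDiffOn ℝ ∞ (fun y => u y (fun i => v i y)) s := by
  induction k with
  | zero =>
    refine ((ContinuousAlternatingMap.apply ℝ E ℝ (0 : Fin 0 → E)).contDiff.comp_contDiffOn
      hu).congr fun y _ => ?_
    exact congrArg (u y) (Subsingleton.elim _ _)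
  | succ k ih =>
    refine (ih (contDiffOn_curryLeft hu (hv 0)) (v := fun i => v i.succ) fun i => hv _).congr
      fun y _ => ?_
    rw [ContinuousAlternatingMap.curryLeft_apply_apply]
    congr 1
    exact (Fin.cons_self_tail (fun i => v i y)).symm

variable [FiniteDimensional ℝ E]

lemma eq_zero_of_finrank_lt {k : ℕ} (hk : Module.finrank ℝ E < k) (u : E [⋀^Fin k]→L[ℝ] ℝ) :
    u = 0 := by
  ext v
  refine u.toAlternatingMap.map_linearDependent v fun hv => ?_
  have := hv.fintype_card_le_finrank
  simp at this
  omega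

/-- A form of top degree killed by a nonzero vector vanishes. -/
lemma eq_zero_of_curryLeft {k : ℕ} (hk : Module.finrank ℝ E = k + 1)
    {u : E [⋀^Fin (k + 1)]→L[ℝ] ℝ} {v : E} (hv : v ≠ 0) (hu : u.curryLeft v = 0) : u = 0 := by
  -- `θ ∧ u` vanishes because its degree exceeds the dimension, while its contraction with `v` is
  -- `u`.
  obtain ⟨θ, hθ⟩ := SeparatingDual.exists_eq_one (R := ℝ) hv
  have hw := curryLeft_wedge θ (v := v) (u := u) hu
  rw [eq_zero_of_finrank_lt (by omega) (wedge θ u), hθ, one_smul] at hw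
  exact hw.symm

/-- Smoothness of families of alternating maps can be tested on vectors. -/
lemma contDiffOn_alternating {G : Type*} [NormedAddCommGroup G] [NormedSpace ℝ G] {k : ℕ}
    {u : G → E [⋀^Fin k]→L[ℝ] ℝ} {s : Set G} (h : ∀ v, ContDiffOn ℝ ∞ (fun y => u y v) s) :
    ContDiffOn ℝ ∞ u s := by
  let b := Module.finBasis ℝ E
  -- Values on tuples of basis vectors determine the form; a linear left inverse recovers it
  -- smoothly from them.
  let Φ : (E [⋀^Fin k]→L[ℝ] ℝ) →L[ℝ] ((Fin k → Fin (Module.finrank ℝ E)) → ℝ) :=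
    ContinuousLinearMap.pi fun i => ContinuousAlternatingMap.apply ℝ E ℝ fun j => b (i j)
  have hΦ : Function.Injective Φ := by
    intro f g hfg
    apply ContinuousAlternatingMap.toAlternatingMap_injective
    refine Module.Basis.ext_alternating b fun i _ => congrFun hfg i
  have : FiniteDimensional ℝ (E [⋀^Fin k]→L[ℝ] ℝ) :=
    FiniteDimensional.of_injective Φ.toLinearMap hΦ
  obtain ⟨Ψ, hΨ⟩ := Φ.toLinearMap.exists_leftInverse_of_injective (LinearMap.ker_eq_bot.2 hΦ)
  have hc : ContDiffOn ℝ ∞ (fun y => Ψ.toContinuousLinearMap (Φ (u y))) s :=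
    Ψ.toContinuousLinearMap.contDiff.comp_contDiffOn
      (contDiffOn_pi.2 fun i => h fun j => b (i j))
  exact hc.congr fun y _ => (LinearMap.congr_fun hΨ (u y)).symm

lemma contDiffOn_compContinuousLinearMap {G F : Type*} [NormedAddCommGroup G] [NormedSpace ℝ G]
    [NormedAddCommGroup F] [NormedSpace ℝ F] [FiniteDimensional ℝ F] {k : ℕ}
    {u : G → F [⋀^Fin k]→L[ℝ] ℝ} {A : G → E →L[ℝ] F} {s : Set G}
    (hu : ContDiffOn ℝ ∞ u s) (hA : ContDiffOn ℝ ∞ A s) :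
    ContDiffOn ℝ ∞ (fun y => (u y).compContinuousLinearMap (A y)) s :=
  contDiffOn_alternating fun _ =>
    contDiffOn_alternating_apply hu fun _ => hA.clm_apply contDiffOn_const

end algebra

/-! ### Local exactness of contraction. -/

section koszul

universe v

variable {E : Type v} [NormedAddCommGroup E] [NormedSpace ℝ E]

/-- Near `a`, the field of forms `u` is the contraction of a smooth field of forms with `X`. -/
def IsContractionNear (X : E → E) {k : ℕ} (u : E → E [⋀^Fin k]→L[ℝ] ℝ) (a : E) : Prop :=
  ∃ η : E → E [⋀^Fin (k + 1)]→L[ℝ] ℝ, ∃ V ∈ 𝓝 a, ContDiffOn ℝ ∞ η V ∧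
    ∀ y ∈ V, (η y).curryLeft (X y) = u y

/-- Exactness of contraction where the field does not vanish. -/
lemma isContractionNear_of_ne {X : E → E} {k : ℕ} {u : E → E [⋀^Fin k]→L[ℝ] ℝ} {U : Set E} {a : E}
    (hU : IsOpen U) (haU : a ∈ U) (hX : ContDiffOn ℝ ∞ X U) (hu : ContDiffOn ℝ ∞ u U)
    (hk : ∀ y ∈ U, Killed (X y) (u y)) (ha : X a ≠ 0) : IsContractionNear X u a := by
  obtain ⟨θ, hθ⟩ := SeparatingDual.exists_eq_one (R := ℝ) ha
  have hc : ContDiffOn ℝ ∞ (fun y => θ (X y)) U := θ.contDiff.comp_contDiffOn hX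
  have h1 : ∀ᶠ y in 𝓝 a, θ (X y) ≠ 0 :=
    (hc.continuousOn.continuousAt (hU.mem_nhds haU)).eventually_ne (by simp [hθ])
  have hV : U ∩ {y | θ (X y) ≠ 0} ∈ 𝓝 a := Filter.inter_mem (hU.mem_nhds haU) h1
  refine ⟨fun y => (θ (X y))⁻¹ • wedge θ (u y), _, hV, ?_, fun y hy => ?_⟩
  · exact ((hc.mono Set.inter_subset_left).inv fun y hy => hy.2).smul
      (contDiffOn_wedge contDiffOn_const (hu.mono Set.inter_subset_left))
  · rw [ContinuousAlternatingMap.curryLeft_smul, _root_.smul_apply,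
      curryLeft_wedge θ (hk y hy.1), smul_smul, inv_mul_cancel₀ hy.2, one_smul]

/-- Euler's formula: contraction of `du` with the radial field when `u` is killed by it. -/
lemma curryLeft_extDeriv_self {k : ℕ} {u : E → E [⋀^Fin k]→L[ℝ] ℝ} (hu : ContDiff ℝ ∞ u)
    (hk : ∀ y, Killed y (u y)) (z : E) :
    (extDeriv u z).curryLeft z = fderiv ℝ u z z + (k : ℝ) • u z := by
  cases k with
  | zero => simp [extDeriv, curryLeft_alternatizeUncurryFin_zero]
  | succ k =>
    have hd : HasFDerivAt u (fderiv ℝ u z) z := (hu.differentiable (by simp) z).hasFDerivAt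
    -- This is the derivative at `t = 0` of the identity `i_{z + tw} u(z + tw) = 0`.
    have h4 : (contractCLM k z).comp (fderiv ℝ u z) = -(u z).curryLeft := by
      refine ContinuousLinearMap.ext fun w => ?_
      have hl : HasDerivAt (fun t : ℝ => z + t • w) w 0 := by
        simpa using ((hasDerivAt_id (0 : ℝ)).smul_const w).const_add z
      have hu0 : HasDerivAt (fun t : ℝ => u (z + t • w)) (fderiv ℝ u z w) 0 :=
        HasFDerivAt.comp_hasDerivAt (l := u) 0 (by simpa using hd) hl
      have h1 : HasDerivAt (fun t : ℝ => contractCLM k z (u (z + t • w)))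
          (contractCLM k z (fderiv ℝ u z w)) 0 :=
        (contractCLM k z).hasFDerivAt.comp_hasDerivAt 0 hu0
      have h2 : HasDerivAt (fun t : ℝ => contractCLM k w (u (z + t • w)))
          (contractCLM k w (fderiv ℝ u z w)) 0 :=
        (contractCLM k w).hasFDerivAt.comp_hasDerivAt 0 hu0
      have h3 := h1.add ((hasDerivAt_id (0 : ℝ)).smul h2)
      have h6 : ∀ t : ℝ, contractCLM k z (u (z + t • w)) + t • contractCLM k w (u (z + t • w)) = 0 := by
        intro t
        have := hk (z + t • w)
        simp only [contractCLM_apply, ← map_smul, ← map_add]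
        exact this
      have h7 := (h3.congr_of_eventuallyEq (f₁ := fun _ => 0)
        (Filter.Eventually.of_forall fun t => (h6 t).symm)).unique (hasDerivAt_const 0 0)
      rw [ContinuousLinearMap.comp_apply, _root_.neg_apply]
      refine eq_neg_of_add_eq_zero_left ?_
      simpa using h7
    -- Alternatizing an already alternating form multiplies it by its degree, here `k + 1`.
    have h5 : ContinuousAlternatingMap.alternatizeUncurryFin (-(u z).curryLeft) =
        -((k + 1) • u z) := by
      rw [← ContinuousAlternatingMap.alternatizeUncurryFin_curryLeft]
      exact map_neg (ContinuousAlternatingMap.alternatizeUncurryFinCLM ℝ E ℝ) _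
    rw [extDeriv, curryLeft_alternatizeUncurryFin, h4, h5, sub_neg_eq_add]
    congr 1
    rw [← Nat.cast_smul_eq_nsmul ℝ]

variable [FiniteDimensional ℝ E]

/-- Exactness of contraction with the radial field. -/
lemma exists_curryLeft_self_eq {k : ℕ} {u : E → E [⋀^Fin k]→L[ℝ] ℝ} (hu : ContDiff ℝ ∞ u)
    (hk : ∀ y, Killed y (u y)) (h0 : k = 0 → u 0 = 0) :
    ∃ v : E → E [⋀^Fin (k + 1)]→L[ℝ] ℝ, ContDiff ℝ ∞ v ∧ ∀ y, (v y).curryLeft y = u y := by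
  have hdu : ContDiff ℝ ∞ (extDeriv u) :=
    (contDiff_alternatizeUncurryFin k).comp (hu.fderiv_right (m := ∞) (by simp))
  -- By Euler's formula at `t • y`, contracting `t ^ k • du(t • y)` with `y` gives the
  -- `t`-derivative of `t ^ k • u (t • y)`; its integral over `[0, 1]` telescopes.
  let G : E → ℝ → E [⋀^Fin (k + 1)]→L[ℝ] ℝ := fun y t => t ^ k • extDeriv u (t • y)
  have hG : ContDiff ℝ ∞ (Function.uncurry G) :=
    (contDiff_snd.pow k).smul (hdu.comp (contDiff_snd.smul contDiff_fst))
  refine ⟨fun y => ∫ t in (0 : ℝ)..1, G y t, contDiff_intervalIntegral_param hG, fun y => ?_⟩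
  have hGy : Continuous (G y) := hG.continuous.comp (Continuous.prodMk_right y)
  rw [← contractCLM_apply, ← ContinuousLinearMap.intervalIntegral_comp_comm _
    (hGy.intervalIntegrable _ _)]
  have hd : ∀ t : ℝ, HasDerivAt (fun t : ℝ => t ^ k • u (t • y)) (contractCLM k y (G y t)) t := by
    intro t
    have h1 : HasDerivAt (fun t : ℝ => u (t • y)) (fderiv ℝ u (t • y) y) t := by
      have h2 : HasDerivAt (fun t : ℝ => t • y) y t := by
        simpa using (hasDerivAt_id t).smul_const y
      exact ((hu.differentiable (by simp)) (t • y)).hasFDerivAt.comp_hasDerivAt t h2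
    have h3 := (hasDerivAt_pow k t).smul h1
    have h4 := curryLeft_extDeriv_self hu hk (t • y)
    refine h3.congr_deriv ?_
    simp only [G, contractCLM_apply, ContinuousAlternatingMap.curryLeft_smul,
      smul_apply]
    cases k with
    | zero => simp [extDeriv, curryLeft_alternatizeUncurryFin_zero]
    | succ k =>
      rw [map_smul, map_smul] at h4
      rw [pow_succ, mul_smul (t ^ k) t (ContinuousAlternatingMap.curryLeft _ _), h4, smul_add,
        smul_smul, smul_smul]
      simp [mul_comm]
  have hi := intervalIntegral.integral_eq_sub_of_hasDerivAt (a := 0) (b := 1)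
    (fun t _ => hd t) (((contractCLM k y).continuous.comp hGy).intervalIntegrable _ _)
  rw [hi]
  -- The boundary term at `t = 0` is `u 0` in degree 0 and carries the factor `0 ^ k` otherwise.
  cases k with
  | zero => simp [h0 rfl]
  | succ k => simp

/-- Exactness of contraction near a non-degenerate zero. -/
lemma isContractionNear_of_nondegenerate {X : E → E} {k : ℕ} {u : E → E [⋀^Fin k]→L[ℝ] ℝ}
    {U : Set E} {a : E} (hU : IsOpen U) (haU : a ∈ U) (hX : ContDiffOn ℝ ∞ X U)
    (hu : ContDiffOn ℝ ∞ u U) (hk : ∀ y ∈ U, Killed (X y) (u y)) (ha : X a = 0)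
    (hb : Function.Bijective (fderiv ℝ X a)) (h0 : k = 0 → u a = 0) :
    IsContractionNear X u a := by
  obtain ⟨χ, hχ, -, hχU, hχ1⟩ := exists_cutoff (hU.mem_nhds haU)
  have hY := contDiff_smul_of_tsupport hU hχ hχU hX
  have hw := contDiff_smul_of_tsupport hU hχ hχU hu
  set Y : E → E := fun y => χ y • X y with hYdef
  have hYX : Y =ᶠ[𝓝 a] X := by
    filter_upwards [hχ1] with y hy
    simp [hYdef, hy]
  -- The mean of the derivative along the segment from `a` to `y` gives `Y y = A y (y - a)`, with `A
  -- a` the invertible Jacobian.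
  let A : E → E →L[ℝ] E := fun y => ∫ t in (0 : ℝ)..1, fderiv ℝ Y (a + t • (y - a))
  have hA : ContDiff ℝ ∞ A := by
    refine contDiff_intervalIntegral_param (f := fun y t => fderiv ℝ Y (a + t • (y - a))) ?_
    refine (hY.fderiv_right (m := ∞) (by simp)).comp ?_
    fun_prop
  have hAY : ∀ y, A y (y - a) = Y y := by
    intro y
    have hc : Continuous fun t : ℝ => fderiv ℝ Y (a + t • (y - a)) :=
      (hY.continuous_fderiv (by simp)).comp (by fun_prop)
    have h1 : A y (y - a) = ∫ t in (0 : ℝ)..1, fderiv ℝ Y (a + t • (y - a)) (y - a) :=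
      ContinuousLinearMap.intervalIntegral_apply (hc.intervalIntegrable _ _) _
    have hd : ∀ t : ℝ, HasDerivAt (fun t : ℝ => Y (a + t • (y - a)))
        (fderiv ℝ Y (a + t • (y - a)) (y - a)) t := by
      intro t
      have h2 : HasDerivAt (fun t : ℝ => a + t • (y - a)) (y - a) t := by
        simpa using ((hasDerivAt_id t).smul_const (y - a)).const_add a
      exact ((hY.differentiable (by simp)) _).hasFDerivAt.comp_hasDerivAt t h2
    rw [h1, intervalIntegral.integral_eq_sub_of_hasDerivAt (fun t _ => hd t)
      ((hc.clm_apply continuous_const).intervalIntegrable _ _)]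
    simp [hYX.self_of_nhds, ha]
  have hAa : A a = fderiv ℝ X a := by simp [A, hYX.fderiv_eq]
  have hunit : IsUnit (A a) := by
    rw [hAa]
    exact ContinuousLinearMap.isUnit_iff_bijective.2 hb
  have hunits : ∀ᶠ y in 𝓝 a, IsUnit (A y) :=
    hA.continuous.continuousAt.eventually (Units.isOpen.mem_nhds hunit)
  -- Contraction is pointwise algebra, so `A` may transport forms although it need not be the
  -- derivative of a diffeomorphism. After the translation `z = y - a`, the transported form is
  -- killed by the radial field.
  obtain ⟨v, hv, hvw⟩ := exists_curryLeft_self_eq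
    (u := fun z => (χ (z + a) • u (z + a)).compContinuousLinearMap (A (z + a)))
    (by
      have := contDiffOn_compContinuousLinearMap (s := Set.univ) hw.contDiffOn hA.contDiffOn
      exact (contDiffOn_univ.1 this).comp (contDiff_id.add contDiff_const))
    (fun z => by
      apply killed_comp
      have : A (z + a) z = Y (z + a) := by simpa using hAY (z + a)
      rw [this]
      by_cases hz : z + a ∈ U
      · exact killed_smul_left _ (killed_smul _ (hk _ hz))
      · rw [image_eq_zero_of_notMem_tsupport fun h => hz (hχU h), zero_smul]
        exact killed_zero _)
    (fun hk0 => by simp only [zero_add, h0 hk0, smul_zero]; rfl)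
  -- `Ring.inverse` is zero at non-units, so the neighbourhood is restricted to points where `A y`
  -- is invertible.
  refine ⟨fun y => (v (y - a)).compContinuousLinearMap (Ring.inverse (A y)),
    {y | IsUnit (A y)} ∩ {y | χ y = 1 ∧ Y y = X y},
    Filter.inter_mem hunits (hχ1.and hYX), ?_, ?_⟩
  · refine contDiffOn_compContinuousLinearMap (hv.comp (contDiff_id.sub contDiff_const)).contDiffOn
      fun y hy => ?_
    obtain ⟨e, he⟩ := hy.1
    have h1 := contDiffAt_ringInverse (n := ∞) ℝ e
    rw [he] at h1
    exact (h1.comp y hA.contDiffAt).contDiffWithinAt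
  · rintro y ⟨hy, hy1, hyX⟩
    have h1 := hvw (y - a)
    rw [ContinuousAlternatingMap.curryLeft_compContinuousLinearMap, ← hyX, ← hAY y]
    have h2 : Ring.inverse (A y) (A y (y - a)) = y - a :=
      congrArg (fun L : E →L[ℝ] E => L (y - a)) (Ring.inverse_mul_cancel _ hy)
    rw [h2, h1]
    ext w
    simp only [sub_add_cancel, hy1, one_smul,
      ContinuousAlternatingMap.compContinuousLinearMap_apply]
    congr 1
    funext i
    exact congrArg (fun L : E →L[ℝ] E => L (w i)) (Ring.mul_inverse_cancel _ hy)

/-- Exactness of contraction in degree `dim E - 1` near an isolated zero, when powers of two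
coordinates lie in the ideal generated by the components of the field. -/
lemma isContractionNear_of_pow_coordinates {X : E → E} {k : ℕ} {w : E → E [⋀^Fin (k + 1)]→L[ℝ] ℝ}
    (hdim : Module.finrank ℝ E = k + 2) {U : Set E} {a : E} (hU : IsOpen U) (haU : a ∈ U)
    (hX : ContDiffOn ℝ ∞ X U) (hw : ContDiffOn ℝ ∞ w U)
    (hk : ∀ y ∈ U, (w y).curryLeft (X y) = 0) (hX0 : ∀ y ∈ U, y ≠ a → X y ≠ 0)
    (l : Fin 2 → E →L[ℝ] ℝ) (e : Fin 2 → E) (hle : ∀ i j, l i (e j) = if i = j then 1 else 0)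
    (r : Fin 2 → ℕ) (q : Fin 2 → E → ℝ) (hq : ∀ i, ContDiffOn ℝ ∞ (q i) U)
    (hq0 : ∀ i, ∀ y ∈ U, q i y ≠ 0) (θ : Fin 2 → E → E →L[ℝ] ℝ)
    (hθ : ∀ i, ContDiffOn ℝ ∞ (θ i) U)
    (hθX : ∀ i, ∀ y ∈ U, θ i y (X y) = l i (y - a) ^ r i * q i y) :
    IsContractionNear X w a := by
  let v : Fin 2 → E → E [⋀^Fin (k + 2)]→L[ℝ] ℝ := fun i y => (q i y)⁻¹ • wedge (θ i y) (w y)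
  have hv : ∀ i, ContDiffOn ℝ ∞ (v i) U := fun i =>
    ((hq i).inv (hq0 i)).smul (contDiffOn_wedge (hθ i) hw)
  have hvX : ∀ i, ∀ y ∈ U, (v i y).curryLeft (X y) = l i (y - a) ^ r i • w y := by
    intro i y hy
    simp only [v, ContinuousAlternatingMap.curryLeft_smul, _root_.smul_apply]
    rw [curryLeft_wedge (θ i y) (show Killed (X y) (w y) from hk y hy), hθX i y hy, smul_smul]
    congr 1
    field_simp [hq0 i y hy]
  obtain ⟨χ, hχ, -, hχU, hχ1⟩ := exists_cutoff (hU.mem_nhds haU)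
  have hev : ∀ i, ContDiff ℝ ∞ fun y => χ y • v i y := fun i =>
    contDiff_smul_of_tsupport hU hχ hχU (hv i)
  -- Both sides have top degree and equal contraction with `X`, so they agree where `X ≠ 0`, in
  -- particular in `U` off the hyperplane of `l 0` through `a`. Outside `U` both vanish with `χ`.
  have heq : ∀ y, l 1 (y - a) ^ r 1 • (χ y • v 0 y) = l 0 (y - a) ^ r 0 • (χ y • v 1 y) := by
    intro y
    rw [← sub_eq_zero]
    refine eq_zero_of_affine (e := e 0)
      (f := fun y => l 1 (y - a) ^ r 1 • (χ y • v 0 y) - l 0 (y - a) ^ r 0 • (χ y • v 1 y))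
      (l 0) (by simp [hle]) a ?_ (Filter.Eventually.of_forall fun z hz => ?_)
    · have h0 := (hev 0).continuous
      have h1 := (hev 1).continuous
      exact Continuous.continuousAt (by fun_prop)
    · by_cases hzU : z ∈ U
      · have hza : z ≠ a := by
          rintro rfl
          simp at hz
        refine eq_zero_of_curryLeft hdim (hX0 z hzU hza) ?_
        have h0 := hvX 0 z hzU
        have h1 := hvX 1 z hzU
        rw [← contractCLM_apply] at h0 h1 ⊢
        simp only [map_sub, map_smul, h0, h1]
        rw [sub_eq_zero, smul_smul, smul_smul, smul_smul, smul_smul]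
        congr 1
        ring
      · simp [image_eq_zero_of_notMem_tsupport fun h => hzU (hχU h)]
  obtain ⟨g, hg, hgv⟩ := exists_eq_pow_smul (l 0) (l 1) (e₀ := e 0) (e₁ := e 1)
    (by simp [hle]) (by simp [hle]) (by simp [hle]) a (r 1) (r 0) (hev 0) (hev 1) heq
  have hN : ∀ᶠ y in 𝓝 a, y ∈ U ∧ χ y = 1 := (hU.eventually_mem haU).and hχ1
  obtain ⟨V, hVN, hV, haV⟩ := mem_nhds_iff.1 hN
  refine ⟨g, V, hV.mem_nhds haV, hg.contDiffOn, fun y hy => ?_⟩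
  have hVU : V ⊆ U := fun z hz => (hVN hz).1
  -- Near `a`, `v 0 = l₀ ^ r₀ • g`; the factor `l₀ ^ r₀` cancels off the hyperplane, and continuity
  -- covers the rest.
  rw [← sub_eq_zero]
  refine eq_zero_of_affine (e := e 0)
    (f := fun y => (g y).curryLeft (X y) - w y) (l 0) (by simp [hle]) a ?_ ?_
  · exact (((contDiffOn_curryLeft hg.contDiffOn (hX.mono hVU)).sub (hw.mono hVU)).continuousOn).continuousAt
      (hV.mem_nhds hy)
  · filter_upwards [hV.mem_nhds hy] with z hz hlz
    have h1 := hgv z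
    rw [(hVN hz).2, one_smul] at h1
    have h2 := hvX 0 z (hVU hz)
    rw [h1, ContinuousAlternatingMap.curryLeft_smul, _root_.smul_apply] at h2
    exact sub_eq_zero.2 (smul_right_injective _ (pow_ne_zero _ hlz) h2)

end koszul

/-! ### From charts to the manifold: extension of germs and partitions of unity. -/

section gluing

variable {n : ℕ} {M : Type*} [TopologicalSpace M]
  [ChartedSpace (EuclideanSpace ℝ (Fin n)) M]

lemma localForm_congr {k : ℕ} {α β : FormField n M k} {x₀ p : M}
    (hp : p ∈ (extChartAt (𝓡 n) x₀).source) (h : ∀ᶠ x in 𝓝 p, α x = β x) :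
    localForm α x₀ =ᶠ[𝓝 (extChartAt (𝓡 n) x₀ p)] localForm β x₀ := by
  have hc : ContinuousAt (extChartAt (𝓡 n) x₀).symm (extChartAt (𝓡 n) x₀ p) :=
    continuousAt_extChartAt_symm' hp
  have h' := hc.eventually (p := fun x => α x = β x) (by
    rwa [(extChartAt (𝓡 n) x₀).left_inv hp])
  filter_upwards [h'] with y hy
  simp only [localForm, hy]

variable [IsManifold (𝓡 n) ∞ M]

/-- The value of a form is determined by its expression in a chart. -/
lemma eq_localForm_comp {k : ℕ} (α : FormField n M k) {x₀ p : M}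
    (hp : p ∈ (extChartAt (𝓡 n) x₀).source) :
    α p = (localForm α x₀ (extChartAt (𝓡 n) x₀ p)).compContinuousLinearMap
      (mfderiv (𝓡 n) (𝓡 n) (extChartAt (𝓡 n) x₀) p) := by
  have : IsManifold (𝓡 n) 1 M := IsManifold.of_le (n := ∞) (by norm_cast)
  have hy := (extChartAt (𝓡 n) x₀).map_source hp
  have h := mfderivWithin_extChartAt_symm_comp_mfderiv_extChartAt (I := 𝓡 n) hy
  rw [modelWithCornersSelf_coe, Set.range_id, mfderivWithin_univ,
    (extChartAt (𝓡 n) x₀).left_inv hp] at h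
  unfold localForm
  rw [(extChartAt (𝓡 n) x₀).left_inv hp]
  ext v
  refine congrArg (α p) (funext fun i => ?_)
  exact (congrArg (fun L => L (v i)) h).symm

lemma eventually_eq_of_localForm {k : ℕ} {α β : FormField n M k} {x₀ p : M}
    (hp : p ∈ (extChartAt (𝓡 n) x₀).source)
    (h : localForm α x₀ =ᶠ[𝓝 (extChartAt (𝓡 n) x₀ p)] localForm β x₀) :
    ∀ᶠ x in 𝓝 p, α x = β x := by
  filter_upwards [(continuousAt_extChartAt' hp).eventually h,
    (isOpen_extChartAt_source x₀).mem_nhds hp] with x hx hxs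
  rw [eq_localForm_comp α hxs, eq_localForm_comp β hxs, hx]

/-- Smoothness of a form can be tested in any charts. -/
lemma mem_forms_of_local {k : ℕ} {α : FormField n M k}
    (h : ∀ p : M, ∃ x₀ : M, p ∈ (extChartAt (𝓡 n) x₀).source ∧
      ∃ V ∈ 𝓝 (extChartAt (𝓡 n) x₀ p), ContDiffOn ℝ ∞ (localForm α x₀) V) :
    α ∈ forms n M k := by
  intro x₁ y hy
  obtain ⟨x₀, hp, V, hV, hα⟩ := h ((extChartAt (𝓡 n) x₁).symm y)
  have hT : ContinuousAt (transMap x₁ x₀) y := (transMap_contDiffAt hy hp).continuousAt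
  obtain ⟨W, hWN, hW, hyW⟩ := mem_nhds_iff.1 ((eventually_overlap hy hp).and (hT.eventually hV))
  have hTW : ContDiffOn ℝ ∞ (transMap x₁ x₀) W := fun z hz =>
    (transMap_contDiffAt (hWN hz).1.1 (hWN hz).1.2).contDiffWithinAt
  have h1 : ContDiffOn ℝ ∞ (localForm α x₁) W :=
    (contDiffOn_compContinuousLinearMap (hα.comp hTW fun z hz => (hWN hz).2)
      (hTW.fderiv_of_isOpen hW (by simp))).congr fun z hz =>
        localForm_eq_pullback α (hWN hz).1.1 (hWN hz).1.2
  exact (h1.contDiffAt (hW.mem_nhds hyW)).contDiffWithinAt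

lemma mem_forms_of_eventually {k : ℕ} {α : FormField n M k}
    (h : ∀ p : M, ∃ β : forms n M k, ∀ᶠ x in 𝓝 p, α x = β.1 x) : α ∈ forms n M k := by
  refine mem_forms_of_local fun p => ⟨p, mem_extChartAt_source p, ?_⟩
  obtain ⟨β, hβ⟩ := h p
  have h1 := localForm_congr (mem_extChartAt_source (I := 𝓡 n) p) hβ
  refine ⟨_, Filter.inter_mem (extChartAt_target_mem_nhds p) h1, ?_⟩
  exact ((β.2 p).mono Set.inter_subset_left).congr fun y hy => hy.2

/-- Functions as `0`-forms. -/
def funForm (f : M → ℝ) (hf : ContMDiff (𝓡 n) 𝓘(ℝ, ℝ) ∞ f) : forms n M 0 :=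
  ⟨fun x => ContinuousAlternatingMap.constOfIsEmpty ℝ (EuclideanSpace ℝ (Fin n)) (Fin 0) (f x),
    fun x₀ => contDiffOn_alternating fun _ => contMDiffOn_iff_contDiffOn.1 <|
      hf.comp_contMDiffOn (contMDiffOn_extChartAt_symm x₀)⟩

variable (n M) in
/-- Evaluation of forms at a point. -/
def evalAt (k : ℕ) (x : M) :
    forms n M k →ₗ[ℝ] (EuclideanSpace ℝ (Fin n) [⋀^Fin k]→L[ℝ] ℝ) where
  toFun u := u.1 x
  map_add' _ _ := rfl
  map_smul' _ _ := rfl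

variable [T2Space M]

/-- Every germ of a smooth form in a chart extends to the manifold. -/
lemma exists_form_localForm_eq {k : ℕ} (x₀ : M)
    {η : EuclideanSpace ℝ (Fin n) → EuclideanSpace ℝ (Fin n) [⋀^Fin k]→L[ℝ] ℝ}
    {V : Set (EuclideanSpace ℝ (Fin n))} (hV : V ∈ 𝓝 (extChartAt (𝓡 n) x₀ x₀))
    (hη : ContDiffOn ℝ ∞ η V) :
    ∃ α : forms n M k, localForm α.1 x₀ =ᶠ[𝓝 (extChartAt (𝓡 n) x₀ x₀)] η := by
  classical
  obtain ⟨W, hWN, hW, haW⟩ := mem_nhds_iff.1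
    (Filter.inter_mem hV (extChartAt_target_mem_nhds (I := 𝓡 n) x₀))
  obtain ⟨χ, hχ, hχc, hχW, hχ1⟩ := exists_cutoff (hW.mem_nhds haW)
  have hs := contDiff_smul_of_tsupport hW hχ hχW (hη.mono fun z hz => (hWN hz).1)
  let α : FormField n M k := fun x =>
    if x ∈ (extChartAt (𝓡 n) x₀).source then
      (χ (extChartAt (𝓡 n) x₀ x) • η (extChartAt (𝓡 n) x₀ x)).compContinuousLinearMap
        (mfderiv (𝓡 n) (𝓡 n) (extChartAt (𝓡 n) x₀) x)
    else 0
  have hα : ∀ y ∈ (extChartAt (𝓡 n) x₀).target, localForm α x₀ y = χ y • η y := by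
    intro y hy
    have hys := (extChartAt (𝓡 n) x₀).map_target hy
    have h1 := fderiv_transMap hy hys
    have h2 : fderiv ℝ (transMap x₀ x₀) y = ContinuousLinearMap.id ℝ _ := by
      have : transMap x₀ x₀ =ᶠ[𝓝 y] id := by
        filter_upwards [(isOpen_extChartAt_target x₀).mem_nhds hy] with z hz
        exact (extChartAt (𝓡 n) x₀).right_inv hz
      rw [this.fderiv_eq, fderiv_id]
    have h3 : α ((extChartAt (𝓡 n) x₀).symm y) = (χ y • η y).compContinuousLinearMap
        (mfderiv (𝓡 n) (𝓡 n) (extChartAt (𝓡 n) x₀) ((extChartAt (𝓡 n) x₀).symm y)) := by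
      simp only [α, if_pos hys, (extChartAt (𝓡 n) x₀).right_inv hy]
    unfold localForm
    rw [h3]
    ext v
    refine congrArg (χ y • η y) (funext fun i => ?_)
    exact congrArg (fun L : EuclideanSpace ℝ (Fin n) →L[ℝ] EuclideanSpace ℝ (Fin n) => L (v i))
      (h1.symm.trans h2)
  have hαm : α ∈ forms n M k := by
    refine mem_forms_of_local fun p => ?_
    by_cases hp : p ∈ (extChartAt (𝓡 n) x₀).source
    · exact ⟨x₀, hp, _, (isOpen_extChartAt_target x₀).mem_nhds
        ((extChartAt (𝓡 n) x₀).map_source hp), hs.contDiffOn.congr hα⟩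
    · refine ⟨p, mem_extChartAt_source p, ?_⟩
      -- Extension by zero is smooth outside the chart because the image of the compact support is
      -- closed in the Hausdorff space `M`.
      have hK : IsClosed ((extChartAt (𝓡 n) x₀).symm '' tsupport χ) :=
        (hχc.isCompact.image_of_continuousOn ((continuousOn_extChartAt_symm x₀).mono
          fun z hz => (hWN (hχW hz)).2)).isClosed
      have hpK : p ∉ (extChartAt (𝓡 n) x₀).symm '' tsupport χ := by
        rintro ⟨z, hz, rfl⟩
        exact hp ((extChartAt (𝓡 n) x₀).map_target (hWN (hχW hz)).2)
      have h0 : ∀ᶠ x in 𝓝 p, α x = (0 : FormField n M k) x := by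
        filter_upwards [hK.isOpen_compl.mem_nhds hpK] with x hx
        by_cases hxs : x ∈ (extChartAt (𝓡 n) x₀).source
        · have : χ (extChartAt (𝓡 n) x₀ x) = 0 := image_eq_zero_of_notMem_tsupport fun h =>
            hx ⟨_, h, (extChartAt (𝓡 n) x₀).left_inv hxs⟩
          simp only [α, if_pos hxs, this, zero_smul]
          rfl
        · simp only [α, if_neg hxs]
          rfl
      exact ⟨_, localForm_congr (mem_extChartAt_source p) h0,
        (contDiffOn_const (c := 0)).congr fun y hy => hy⟩
  refine ⟨⟨α, hαm⟩, ?_⟩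
  filter_upwards [extChartAt_target_mem_nhds (I := 𝓡 n) x₀, hχ1] with y hy hy1
  rw [hα y hy, hy1, Pi.one_apply, one_smul]

variable [SigmaCompactSpace M]

/-- The image of `i_X` is determined locally. -/
lemma mem_range_iota_of_eventually (X : Field n M) {k : ℕ} (u : forms n M k)
    (h : ∀ p : M, ∃ v : forms n M (k + 1), ∀ᶠ x in 𝓝 p, (iota X k v).1 x = u.1 x) :
    u ∈ LinearMap.range (iota X k) := by
  choose v hv using h
  obtain ⟨ρ, hρ⟩ := SmoothPartitionOfUnity.exists_isSubordinate (𝓡 n) (isClosed_univ (X := M))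
    (fun p => interior {x | (iota X k (v p)).1 x = u.1 x}) (fun p => isOpen_interior)
    (fun x _ => Set.mem_iUnion.2 ⟨x, mem_interior_iff_mem_nhds.2 (hv x)⟩)
  -- The sum of `ρ i • v i` is a global primitive: `i_X` commutes with multiplication by `ρ i`, and
  -- `i_X (v i) = u` on the support of `ρ i`.
  let w : M → forms n M (k + 1) := fun i => mulForm (funForm (ρ i) (ρ i).contMDiff) (v i)
  let α : FormField n M (k + 1) := fun x => ∑ᶠ i, evalAt n M (k + 1) x (w i)
  have hloc : ∀ p, ∃ s : Finset M, ∀ᶠ x in 𝓝 p, α x = evalAt n M (k + 1) x (∑ i ∈ s, w i) ∧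
      ∀ i ∉ s, ρ i x = 0 := by
    intro p
    obtain ⟨W, hW, hfin⟩ := ρ.locallyFinite p
    refine ⟨hfin.toFinset, ?_⟩
    filter_upwards [hW] with x hx
    have h0 : ∀ i ∉ hfin.toFinset, ρ i x = 0 := by
      intro i hi
      by_contra hne
      exact hi (hfin.mem_toFinset.2 ⟨x, hne, hx⟩)
    refine ⟨?_, h0⟩
    rw [map_sum]
    refine finsum_eq_sum_of_support_subset _ fun i hi => ?_
    by_contra hne
    refine hi ?_
    change ρ i x • (v i).1 x = 0
    rw [h0 i hne, zero_smul]
  have hα : α ∈ forms n M (k + 1) := mem_forms_of_eventually fun p => by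
    obtain ⟨s, hs⟩ := hloc p
    exact ⟨∑ i ∈ s, w i, hs.mono fun x hx => hx.1⟩
  refine ⟨⟨α, hα⟩, Subtype.ext (funext fun x => ?_)⟩
  obtain ⟨s, hs⟩ := hloc x
  obtain ⟨hx, hx0⟩ := hs.self_of_nhds
  have h1 : (iota X k ⟨α, hα⟩).1 x = evalAt n M k x (iota X k (∑ i ∈ s, w i)) :=
    congrArg (fun a : EuclideanSpace ℝ (Fin n) [⋀^Fin (k + 1)]→L[ℝ] ℝ => a.curryLeft (X x)) hx
  rw [h1, map_sum, map_sum]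
  have h2 : ∀ i, evalAt n M k x (iota X k (w i)) = ρ i x • evalAt n M k x u := by
    intro i
    have h3 : evalAt n M k x (iota X k (w i)) = ρ i x • evalAt n M k x (iota X k (v i)) := rfl
    by_cases hi : ρ i x = 0
    · rw [h3, hi, zero_smul, zero_smul]
    · have h4 : x ∈ {x | (iota X k (v i)).1 x = u.1 x} :=
        interior_subset (hρ i (subset_tsupport _ hi))
      rw [h3]
      exact congrArg _ h4
  simp only [h2]
  rw [← Finset.sum_smul]
  have h5 : ∑ i ∈ s, ρ i x = 1 := by
    rw [← ρ.sum_eq_one (Set.mem_univ x)]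
    refine (finsum_eq_sum_of_support_subset _ fun i hi => ?_).symm
    by_contra hne
    exact hi (hx0 i hne)
  rw [h5, one_smul]
  rfl

/-- The image of `i_X` can be computed in charts. -/
lemma mem_range_iota_of_isContractionNear (X : Field n M) {k : ℕ} (u : forms n M k)
    (h : ∀ p : M, IsContractionNear (localField X p) (localForm u.1 p) (extChartAt (𝓡 n) p p)) :
    u ∈ LinearMap.range (iota X k) := by
  refine mem_range_iota_of_eventually X u fun p => ?_
  obtain ⟨η, V, hV, hη, hηu⟩ := h p
  obtain ⟨v, hv⟩ := exists_form_localForm_eq p hV hη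
  refine ⟨v, eventually_eq_of_localForm (mem_extChartAt_source p) ?_⟩
  filter_upwards [hv, hV, extChartAt_target_mem_nhds (I := 𝓡 n) p] with y hy hyV hyt
  rw [← hηu y hyV, ← hy]
  exact localForm_contractAt X v.1 hyt

end gluing

/-! ### Global exactness of contraction under the hypotheses on the zeros. -/

section exactness

variable {n : ℕ} {M : Type*} [TopologicalSpace M]
  [ChartedSpace (EuclideanSpace ℝ (Fin n)) M] [IsManifold (𝓡 n) ∞ M] (X : Field n M)

lemma killed_localForm {k : ℕ} {u : forms n M k} (hu : u ∈ lambdaX X k) {x₀ : M}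
    {y : EuclideanSpace ℝ (Fin n)} (hy : y ∈ (extChartAt (𝓡 n) x₀).target) :
    Killed (localField X x₀ y) (localForm u.1 x₀ y) := by
  cases k with
  | zero => trivial
  | succ k =>
    have h : contractAt X u.1 = 0 := congrArg Subtype.val (show iota X k u = 0 from hu)
    have h1 := localForm_contractAt X u.1 hy
    rw [h] at h1
    exact h1.symm

lemma localField_eq_zero_iff {x₀ : M} {y : EuclideanSpace ℝ (Fin n)}
    (hy : y ∈ (extChartAt (𝓡 n) x₀).target) :
    localField X x₀ y = 0 ↔ (extChartAt (𝓡 n) x₀).symm y ∈ zeros X := by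
  constructor
  · intro h
    have h1 := mfderiv_symm_localField X hy
    rw [h] at h1
    exact h1.symm.trans
      (map_zero (mfderiv (𝓡 n) (𝓡 n) (extChartAt (𝓡 n) x₀).symm y))
  · intro h
    have h1 : X ((extChartAt (𝓡 n) x₀).symm y) = 0 := h
    unfold localField
    rw [h1, map_zero]
    rfl

lemma localField_self_eq_zero_iff (p : M) :
    localField X p (extChartAt (𝓡 n) p p) = 0 ↔ p ∈ zeros X := by
  rw [localField_eq_zero_iff X (mem_extChartAt_target p), extChartAt_to_inv]

lemma isContractionNear_of_notMem_zeros {k : ℕ} {u : forms n M k} (hu : u ∈ lambdaX X k) {p : M}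
    (hp : p ∉ zeros X) :
    IsContractionNear (localField X p) (localForm u.1 p) (extChartAt (𝓡 n) p p) :=
  isContractionNear_of_ne (isOpen_extChartAt_target p) (mem_extChartAt_target p)
    (localField_contDiffOn X X.contMDiff p) (u.2 p) (fun _ hy => killed_localForm X hu hy)
    (mt (localField_self_eq_zero_iff X p).1 hp)

/-- A punctured neighbourhood of an isolated zero contains no zeros in the chart. -/
lemma eventually_localField_ne_zero {x : M} (hx : ∀ᶠ y in 𝓝[≠] x, y ∉ zeros X) :
    ∀ᶠ y in 𝓝 (extChartAt (𝓡 n) x x), y ≠ extChartAt (𝓡 n) x x → localField X x y ≠ 0 := by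
  rw [eventually_nhdsWithin_iff] at hx
  have hc : ContinuousAt (extChartAt (𝓡 n) x).symm (extChartAt (𝓡 n) x x) :=
    continuousAt_extChartAt_symm x
  have h1 := hc.eventually (p := fun y => y ∈ ({x}ᶜ : Set M) → y ∉ zeros X) (by
    rwa [extChartAt_to_inv])
  filter_upwards [h1, extChartAt_target_mem_nhds (I := 𝓡 n) x] with y hy hyt hne
  rw [Ne, localField_eq_zero_iff X hyt]
  refine hy fun h => hne ?_
  have h : (extChartAt (𝓡 n) x).symm y = x := h
  rw [← (extChartAt (𝓡 n) x).right_inv hyt, h]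

/-- Forms agreeing off isolated zeros are equal. -/
lemma forms_ext_of_isolated (hn : 0 < n) (hX : ∀ x ∈ zeros X, ∀ᶠ y in 𝓝[≠] x, y ∉ zeros X) {k : ℕ}
    {u v : forms n M k} (h : ∀ x ∉ zeros X, u.1 x = v.1 x) : u = v := by
  refine Subtype.ext (funext fun x => ?_)
  by_cases hx : x ∈ zeros X
  · have : Nontrivial (EuclideanSpace ℝ (Fin n)) := by
      have : Nonempty (Fin n) := ⟨⟨0, hn⟩⟩
      infer_instance
    -- A line through the zero approaches it by points where `X ≠ 0`; this needs positive dimension.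
    obtain ⟨e, he⟩ := exists_ne (0 : EuclideanSpace ℝ (Fin n))
    rw [eq_localForm_comp u.1 (mem_extChartAt_source x),
      eq_localForm_comp v.1 (mem_extChartAt_source x)]
    congr 1
    rw [← sub_eq_zero]
    have ht := extChartAt_target_mem_nhds (I := 𝓡 n) x
    refine eq_zero_of_line (e := e) (f := fun y => localForm u.1 x y - localForm v.1 x y)
      (((u.2 x).sub (v.2 x)).continuousOn.continuousAt ht) ?_
    have hl : Filter.Tendsto (fun t : ℝ => extChartAt (𝓡 n) x x + t • e) (𝓝[≠] 0)
        (𝓝 (extChartAt (𝓡 n) x x)) := by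
      have : Continuous fun t : ℝ => extChartAt (𝓡 n) x x + t • e := by fun_prop
      simpa using (this.tendsto 0).mono_left nhdsWithin_le_nhds
    filter_upwards [hl.eventually (eventually_localField_ne_zero X (hX x hx)), hl ht,
      self_mem_nhdsWithin] with t h1 h2 h3
    have h4 : localField X x (extChartAt (𝓡 n) x x + t • e) ≠ 0 := h1 (by
      have : t ≠ 0 := h3
      simp [he, this])
    rw [Ne, localField_eq_zero_iff X h2] at h4
    have h5 := h _ h4
    simp only [localForm, h5, sub_self]
  · exact h x hx

lemma range_iotaX_eq_top_iff {k : ℕ} : LinearMap.range (iotaX X k) = ⊤ ↔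
    lambdaX X k ≤ LinearMap.range (iota X k) := by
  rw [eq_top_iff]
  constructor
  · intro h u hu
    obtain ⟨v, hv⟩ := h (Submodule.mem_top (x := (⟨u, hu⟩ : lambdaX X k)))
    exact ⟨v, congrArg Subtype.val hv⟩
  · rintro h ⟨u, hu⟩ -
    obtain ⟨v, hv⟩ := h hu
    exact ⟨v, Subtype.ext hv⟩

lemma C_eq_top {k : ℕ} (h : lambdaX X k ≤ LinearMap.range (iota X k)) : C X k = ⊤ := by
  rw [C, (range_iotaX_eq_top_iff X).2 h, Submodule.map_top, Submodule.range_mkQ]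

variable [T2Space M]

/-- At a zero with finite Milnor index, a power of each coordinate lies in the ideal of the field,
up to a unit. -/
lemma exists_pow_coordinate {x : M} (hfin : FiniteDimensional ℝ (LocalAlgebra X x))
    (l : EuclideanSpace ℝ (Fin n) →L[ℝ] ℝ) :
    ∃ (r : ℕ) (q : Polynomial ℝ) (u : forms n M 1), q.eval 0 ≠ 0 ∧
      ∀ᶠ y in 𝓝 (extChartAt (𝓡 n) x x), (localForm u.1 x y).curryLeft (localField X x y) 0 =
        l (y - extChartAt (𝓡 n) x x) ^ r * q.eval (l (y - extChartAt (𝓡 n) x x)) := by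
  set a := extChartAt (𝓡 n) x x with ha
  have hp : ∀ j : ℕ, ∃ f : forms n M 0, localForm f.1 x =ᶠ[𝓝 a] fun y =>
      ContinuousAlternatingMap.constOfIsEmpty ℝ (EuclideanSpace ℝ (Fin n)) (Fin 0)
        (l (y - a) ^ j) := fun j =>
    exists_form_localForm_eq x (V := Set.univ) Filter.univ_mem (contDiffOn_alternating fun _ =>
      ((l.contDiff.comp (contDiff_id.sub contDiff_const)).pow j).contDiffOn)
  choose f hf using hp
  -- A finite-dimensional local algebra forces a relation among the powers of the coordinate, so
  -- some nonzero polynomial in it lies in the ideal.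
  have hnl : ¬ LinearIndependent ℝ fun j : ℕ =>
      (Submodule.Quotient.mk (f j) : LocalAlgebra X x) := fun hli =>
    not_finite_iff_infinite.2 inferInstance hli.finite
  obtain ⟨s, c, hsum, i, his, hci⟩ := not_linearIndependent_iff.1 hnl
  let P : Polynomial ℝ := ∑ j ∈ s, Polynomial.monomial j (c j)
  have hP : P ≠ 0 := by
    intro hP0
    have h1 : P.coeff i = 0 := by rw [hP0, Polynomial.coeff_zero]
    simp [P, Polynomial.coeff_monomial, his] at h1
    exact hci h1
  -- Splitting off the root 0 leaves a factor that is a unit near the zero.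
  obtain ⟨q, hq, hqd⟩ := Polynomial.exists_eq_pow_rootMultiplicity_mul_and_not_dvd P hP 0
  have hmem : (∑ j ∈ s, c j • f j) ∈ localIdeal X x := by
    rw [← Submodule.Quotient.mk_eq_zero, ← hsum]
    simp only [← Submodule.mkQ_apply, map_sum, map_smul]
  obtain ⟨u, hu⟩ := hmem
  refine ⟨P.rootMultiplicity 0, q, u, ?_, ?_⟩
  · rwa [Polynomial.dvd_iff_isRoot] at hqd
  · have h1 := localForm_congr (mem_extChartAt_source (I := 𝓡 n) x) hu
    have h2 : ∀ᶠ y in 𝓝 a, ∀ j ∈ s, localForm (f j).1 x y =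
        ContinuousAlternatingMap.constOfIsEmpty ℝ (EuclideanSpace ℝ (Fin n)) (Fin 0)
          (l (y - a) ^ j) := (Filter.eventually_all_finset s).2 fun j _ => hf j
    filter_upwards [h1, h2, extChartAt_target_mem_nhds (I := 𝓡 n) x] with y hy1 hy2 hyt
    have h3 := localForm_contractAt X u.1 hyt
    rw [← h3]
    have h4 : localForm (contractAt X u.1) x y = localForm (∑ j ∈ s, c j • f j).1 x y := hy1
    have h5 : localForm (∑ j ∈ s, c j • f j).1 x y = ∑ j ∈ s, c j • localForm (f j).1 x y := by
      let Λ : forms n M 0 →ₗ[ℝ] (EuclideanSpace ℝ (Fin n) [⋀^Fin 0]→L[ℝ] ℝ) :=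
        { toFun := fun g => localForm g.1 x y, map_add' := fun _ _ => rfl
          map_smul' := fun _ _ => rfl }
      change Λ (∑ j ∈ s, c j • f j) = ∑ j ∈ s, c j • Λ (f j)
      simp only [map_sum, map_smul]
    rw [h4, h5, Finset.sum_congr rfl fun j hj => by rw [hy2 j hj]]
    have h6 : P.eval (l (y - a)) = ∑ j ∈ s, c j * l (y - a) ^ j := by
      simp [P, Polynomial.eval_finsetSum]
    have h7 : P.eval (l (y - a)) = l (y - a) ^ P.rootMultiplicity 0 * q.eval (l (y - a)) := by
      conv_lhs => rw [hq]
      simp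
    rw [← h7, h6, ContinuousAlternatingMap.sum_apply]
    rfl

variable [SigmaCompactSpace M]

lemma lambdaX_le_of_zeros_empty (h : zeros X = ∅) (k : ℕ) :
    lambdaX X k ≤ LinearMap.range (iota X k) := fun u hu =>
  mem_range_iota_of_isContractionNear X u fun p =>
    isContractionNear_of_notMem_zeros X hu (by simp [h])

/-- Exactness of contraction for fields with non-degenerate zeros. -/
lemma mem_range_iota_of_nondegenerate (h : ∀ x ∈ zeros X, IsNondegenerateAt X x) {k : ℕ}
    {u : forms n M k} (hu : u ∈ lambdaX X k) (h0 : k = 0 → ∀ x ∈ zeros X, u.1 x = 0) :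
    u ∈ LinearMap.range (iota X k) := by
  refine mem_range_iota_of_isContractionNear X u fun p => ?_
  by_cases hp : p ∈ zeros X
  · refine isContractionNear_of_nondegenerate (isOpen_extChartAt_target p)
      (mem_extChartAt_target p) (localField_contDiffOn X X.contMDiff p) (u.2 p)
      (fun _ hy => killed_localForm X hu hy) ((localField_self_eq_zero_iff X p).2 hp) (h p hp) ?_
    intro hk
    unfold localForm
    rw [extChartAt_to_inv, h0 hk p hp]
    rfl
  · exact isContractionNear_of_notMem_zeros X hu hp

/-- Exactness of contraction in degree `n - 1 > 0` for fields of finite type. -/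
lemma lambdaX_le_of_isFiniteType {m : ℕ} (hn : n = m + 2) (hX : IsFiniteType X) :
    lambdaX X (m + 1) ≤ LinearMap.range (iota X (m + 1)) := by
  intro u hu
  refine mem_range_iota_of_isContractionNear X u fun p => ?_
  by_cases hp : p ∈ zeros X
  · subst hn
    obtain ⟨hiso, hfin⟩ := hX p hp
    let l : Fin 2 → EuclideanSpace ℝ (Fin (m + 2)) →L[ℝ] ℝ := fun i =>
      EuclideanSpace.proj (Fin.castLE (by omega) i)
    let e : Fin 2 → EuclideanSpace ℝ (Fin (m + 2)) := fun i =>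
      EuclideanSpace.single (Fin.castLE (by omega) i) 1
    choose r q v hq0 hv using fun i => exists_pow_coordinate X hfin (l i)
    set a := extChartAt (𝓡 (m + 2)) p p with ha
    have hq : ∀ᶠ y in 𝓝 a, ∀ i, (q i).eval (l i (y - a)) ≠ 0 := by
      refine Filter.eventually_all.2 fun i => ?_
      have : ContinuousAt (fun y => (q i).eval (l i (y - a))) a := by fun_prop
      exact this.eventually_ne (by simpa using hq0 i)
    obtain ⟨U, hUN, hU, haU⟩ := mem_nhds_iff.1 ((hq.and (Filter.eventually_all.2 hv)).and
      ((eventually_localField_ne_zero X hiso).and (extChartAt_target_mem_nhds (I := 𝓡 (m + 2)) p)))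
    have hUt : U ⊆ (extChartAt (𝓡 (m + 2)) p).target := fun y hy => (hUN hy).2.2
    refine isContractionNear_of_pow_coordinates (by simp) hU haU
      ((localField_contDiffOn X X.contMDiff p).mono hUt) ((u.2 p).mono hUt)
      (fun y hy => killed_localForm X hu (hUt hy)) (fun y hy => (hUN hy).2.1) l e ?_ r
      (fun i y => (q i).eval (l i (y - a))) ?_ (fun i y hy => (hUN hy).1.1 i)
      -- The 1-form `v i`, read as a linear form: contract with a vector, then evaluate the
      -- resulting 0-form.
      (fun i y => (ContinuousAlternatingMap.apply ℝ (EuclideanSpace ℝ (Fin (m + 2))) ℝ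
        (0 : Fin 0 → EuclideanSpace ℝ (Fin (m + 2)))).comp (localForm (v i).1 p y).curryLeft)
      ?_ (fun i y hy => (hUN hy).1.2 i)
    · intro i j
      have h1 : l i (e j) = if Fin.castLE (by omega : 2 ≤ m + 2) i =
          Fin.castLE (by omega : 2 ≤ m + 2) j then 1 else 0 :=
        PiLp.single_apply 2 ℝ (Fin.castLE (by omega : 2 ≤ m + 2) j) 1 (Fin.castLE (by omega) i)
      rw [h1]
      simp
    · intro i
      exact ((Polynomial.contDiff_aeval (q i) ∞).comp ((l i).contDiff.comp
        (contDiff_id.sub contDiff_const))).contDiffOn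
    · intro i
      exact contDiffOn_const.clm_comp
        ((contDiff_curryLeft 0).comp_contDiffOn (((v i).2 p).mono hUt))
  · exact isContractionNear_of_notMem_zeros X hu hp

end exactness

/-! ### Linear algebra and the product rule for top degree. -/

section linear

lemma exists_quotient_equiv {V W : Type*} [AddCommGroup V] [Module ℝ V] [AddCommGroup W]
    [Module ℝ W] {p : Submodule ℝ V} (φ : V →ₗ[ℝ] W) (hker : LinearMap.ker φ = p)
    (hsurj : Function.Surjective φ) :
    ∃ e : (V ⧸ p) ≃ₗ[ℝ] W, ∀ v, e (Submodule.Quotient.mk v) = φ v := by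
  subst hker
  exact ⟨φ.quotKerEquivOfSurjective hsurj, fun v => rfl⟩

/-- `θ ∧ s` vanishes for degree reasons, so both terms of the antiderivation rule for its
contraction with `v` coincide. -/
lemma wedge_curryLeft_of_finrank {E : Type*} [NormedAddCommGroup E] [NormedSpace ℝ E]
    [FiniteDimensional ℝ E] {k : ℕ} (hk : Module.finrank ℝ E = k + 1) (θ : E →L[ℝ] ℝ)
    (s : E [⋀^Fin (k + 1)]→L[ℝ] ℝ) (v : E) : wedge θ (s.curryLeft v) = θ v • s := by
  have h1 : wedge θ s = 0 := eq_zero_of_finrank_lt (by omega) _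
  have h2 := curryLeft_alternatizeUncurryFin (θ.smulRight s) v
  have h3 : (contractCLM k v).comp (θ.smulRight s) = θ.smulRight (s.curryLeft v) := by
    ext w : 1
    simp
  rw [h3] at h2
  change (wedge θ s).curryLeft v = θ v • s - wedge θ (s.curryLeft v) at h2
  rw [h1] at h2
  exact (sub_eq_zero.1 h2.symm).symm

lemma extDeriv_smul_fun {E : Type*} [NormedAddCommGroup E] [NormedSpace ℝ E] {k : ℕ} {f : E → ℝ}
    {β : E → E [⋀^Fin k]→L[ℝ] ℝ} {y : E} (hf : DifferentiableAt ℝ f y)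
    (hβ : DifferentiableAt ℝ β y) :
    extDeriv (fun z => f z • β z) y = f y • extDeriv β y + wedge (fderiv ℝ f y) (β y) := by
  have h : fderiv ℝ (fun z => f z • β z) y =
      f y • fderiv ℝ β y + (fderiv ℝ f y).smulRight (β y) := fderiv_fun_smul hf hβ
  rw [extDeriv, h, ContinuousAlternatingMap.alternatizeUncurryFin_add,
    ContinuousAlternatingMap.alternatizeUncurryFin_smul]
  rfl

end linear

/-! ### Forms of top degree: `H_X^n`, cokernels and volume forms. -/

section top

variable {n : ℕ} {M : Type*} [TopologicalSpace M]
  [ChartedSpace (EuclideanSpace ℝ (Fin n)) M]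

lemma form_eq_zero_of_lt {k : ℕ} (hk : n < k) (u : forms n M k) : u = 0 :=
  Subtype.ext <| funext fun x => eq_zero_of_finrank_lt (E := EuclideanSpace ℝ (Fin n))
    (by simpa using hk) (u.1 x)

lemma mulForm_injective {k : ℕ} {s : forms n M k} (hs : ∀ x, s.1 x ≠ 0) {f g : forms n M 0}
    (h : mulForm f s = mulForm g s) : f = g := by
  refine Subtype.ext (funext fun x => ?_)
  have key : ∀ (c d : ℝ) (t : EuclideanSpace ℝ (Fin n) [⋀^Fin k]→L[ℝ] ℝ), t ≠ 0 → c • t = d • t →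
      c = d := fun _ _ _ ht hcd => smul_left_injective ℝ ht hcd
  refine ContinuousAlternatingMap.ext (M := EuclideanSpace ℝ (Fin n)) fun v => ?_
  rw [Subsingleton.elim v 0]
  exact key _ _ (s.1 x) (hs x) (congrFun (congrArg Subtype.val h) x)

variable [IsManifold (𝓡 n) ∞ M]

lemma mem_closedForms {m : ℕ} (hn : n = m + 1) (u : forms n M (m + 1)) :
    u ∈ closedForms n M (m + 1) := form_eq_zero_of_lt (by omega) _

lemma closedForms_eq_top {m : ℕ} (hn : n = m + 1) : closedForms n M (m + 1) = ⊤ :=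
  eq_top_iff.2 fun u _ => mem_closedForms hn u

lemma form_ext_localForm {k : ℕ} {u v : forms n M k}
    (h : ∀ x, localForm u.1 x (extChartAt (𝓡 n) x x) = localForm v.1 x (extChartAt (𝓡 n) x x)) :
    u = v := by
  refine Subtype.ext (funext fun x => ?_)
  rw [eq_localForm_comp u.1 (mem_extChartAt_source x),
    eq_localForm_comp v.1 (mem_extChartAt_source x), h]

lemma localForm_ne_zero {k : ℕ} {α : FormField n M k} (hα : ∀ x, α x ≠ 0) {x₀ : M}
    {y : EuclideanSpace ℝ (Fin n)} (hy : y ∈ (extChartAt (𝓡 n) x₀).target) :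
    localForm α x₀ y ≠ 0 := by
  intro h
  have h1 := eq_localForm_comp α ((extChartAt (𝓡 n) x₀).map_target hy)
  rw [(extChartAt (𝓡 n) x₀).right_inv hy, h] at h1
  exact hα _ h1

variable (X : Field n M)

lemma range_iota_le (k : ℕ) : LinearMap.range (iota X k) ≤ lambdaX X k := by
  rintro _ ⟨u, rfl⟩
  exact (iotaX X k u).2

lemma lieD_top {m : ℕ} (hn : n = m + 1) (u : forms n M (m + 1)) :
    lieD X (m + 1) u = extD m (iota X m u) := by
  have h : extD (m + 1) u = 0 := form_eq_zero_of_lt (by omega) _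
  simp [lieD, h]

/-- In top degree `∇_X = d i_X`, so its image is `d` of `Im i_X`, which exactness identifies with
`Λ_X^{n-1}`. -/
lemma exactX_eq_range_lieD {m : ℕ} (hn : n = m + 1)
    (h : lambdaX X m ≤ LinearMap.range (iota X m)) :
    exactX X (m + 1) = LinearMap.range (lieD X (m + 1)) := by
  have h1 : lambdaX X m = LinearMap.range (iota X m) := le_antisymm h (range_iota_le X m)
  have h2 : lieD X (m + 1) = extD m ∘ₗ iota X m := LinearMap.ext fun u => lieD_top X hn u
  rw [h2, LinearMap.range_comp, ← h1]
  rfl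

/-- The Leibniz rule for the Lie derivative in top degree. -/
lemma lieD_mulForm {m : ℕ} (hn : n = m + 1) (f : forms n M 0) (s : forms n M (m + 1)) :
    lieD X (m + 1) (mulForm f s) = mulForm (lieD X 0 f) s + mulForm f (lieD X (m + 1) s) := by
  refine form_ext_localForm fun x => ?_
  set a := extChartAt (𝓡 n) x x with ha
  have hat : a ∈ (extChartAt (𝓡 n) x).target := mem_extChartAt_target x
  have htn := extChartAt_target_mem_nhds (I := 𝓡 n) x
  set F : EuclideanSpace ℝ (Fin n) → ℝ := fun y => localForm f.1 x y 0 with hF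
  have hmul : ∀ {k : ℕ} (g : forms n M 0) (t : forms n M k) (y : EuclideanSpace ℝ (Fin n)),
      localForm (mulForm g t).1 x y = localForm g.1 x y 0 • localForm t.1 x y := by
    intro k g t y
    have h0 : localForm g.1 x y 0 = g.1 ((extChartAt (𝓡 n) x).symm y) 0 :=
      congrArg (g.1 ((extChartAt (𝓡 n) x).symm y)) (Subsingleton.elim _ _)
    rw [h0]
    rfl
  have hfd : DifferentiableAt ℝ (localForm f.1 x) a :=
    ((f.2 x).contDiffAt htn).differentiableAt (by simp)
  have hFd : HasFDerivAt F ((ContinuousAlternatingMap.apply ℝ (EuclideanSpace ℝ (Fin n)) ℝ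
      (0 : Fin 0 → EuclideanSpace ℝ (Fin n))).comp (fderiv ℝ (localForm f.1 x) a)) a :=
    (ContinuousAlternatingMap.apply ℝ (EuclideanSpace ℝ (Fin n)) ℝ
      (0 : Fin 0 → EuclideanSpace ℝ (Fin n))).hasFDerivAt.comp a hfd.hasFDerivAt
  set β := localForm (iota X m s).1 x with hβ
  have hβd : DifferentiableAt ℝ β a :=
    (((iota X m s).2 x).contDiffAt htn).differentiableAt (by simp)
  have hβa : β a = (localForm s.1 x a).curryLeft (localField X x a) :=
    localForm_contractAt X s.1 hat
  have h1 : localForm (lieD X (m + 1) (mulForm f s)).1 x a =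
      F a • extDeriv β a + wedge (fderiv ℝ F a) (β a) := by
    rw [lieD_top X hn]
    refine (localForm_extDerivAt (iota X m (mulForm f s)).2 hat).trans ?_
    rw [← extDeriv_smul_fun hFd.differentiableAt hβd]
    exact congrArg (fun g => extDeriv g a) (funext fun y => hmul f (iota X m s) y)
  have h2 : localForm (lieD X 0 f).1 x a 0 = fderiv ℝ F a (localField X x a) := by
    have h3 : localForm (lieD X 0 f).1 x a =
        (localForm (extD 0 f).1 x a).curryLeft (localField X x a) :=
      localForm_contractAt X (extD 0 f).1 hat
    have h4 : localForm (extD 0 f).1 x a = extDeriv (localForm f.1 x) a :=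
      localForm_extDerivAt f.2 hat
    rw [h3, h4, extDeriv, curryLeft_alternatizeUncurryFin_zero, hFd.fderiv]
    rfl
  have h5 : localForm (lieD X (m + 1) s).1 x a = extDeriv β a := by
    rw [lieD_top X hn]
    exact localForm_extDerivAt (iota X m s).2 hat
  -- With `β = i_X s`, the term `df ∧ β` becomes `df(X) s` in top degree.
  rw [h1, hβa, wedge_curryLeft_of_finrank (by simpa using hn)]
  have h6 : localForm (mulForm (lieD X 0 f) s + mulForm f (lieD X (m + 1) s)).1 x a =
      localForm (mulForm (lieD X 0 f) s).1 x a + localForm (mulForm f (lieD X (m + 1) s)).1 x a :=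
    rfl
  rw [h6, hmul, hmul, h2, h5]
  exact add_comm _ _

/-- Every form of top degree is a smooth multiple of a volume form. -/
lemma exists_mulForm_eq {m : ℕ} (hn : n = m + 1) {s : forms n M (m + 1)} (hs : ∀ x, s.1 x ≠ 0)
    (u : forms n M (m + 1)) : ∃ f : forms n M 0, mulForm f s = u := by
  subst hn
  let b := (EuclideanSpace.basisFun (Fin (m + 1)) ℝ).toBasis
  have hdet : ∀ w : EuclideanSpace ℝ (Fin (m + 1)) [⋀^Fin (m + 1)]→L[ℝ] ℝ, ∀ v,
      w v = w b * b.det v := fun w v =>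
    congrArg (fun A => A v) (AlternatingMap.eq_smul_basis_det b w.toAlternatingMap)
  have hne : ∀ w : EuclideanSpace ℝ (Fin (m + 1)) [⋀^Fin (m + 1)]→L[ℝ] ℝ, w ≠ 0 → w b ≠ 0 := by
    intro w hw h0
    refine hw (ContinuousAlternatingMap.ext fun v => ?_)
    rw [hdet w v, h0, zero_mul]
    rfl
  let f : M → ℝ := fun x =>
    (show EuclideanSpace ℝ (Fin (m + 1)) [⋀^Fin (m + 1)]→L[ℝ] ℝ from u.1 x) b /
      (show EuclideanSpace ℝ (Fin (m + 1)) [⋀^Fin (m + 1)]→L[ℝ] ℝ from s.1 x) b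
  have key : ∀ w t : EuclideanSpace ℝ (Fin (m + 1)) [⋀^Fin (m + 1)]→L[ℝ] ℝ, t ≠ 0 →
      (w b / t b) • t = w := by
    intro w t ht
    ext v
    have h1 := hne t ht
    rw [ContinuousAlternatingMap.smul_apply, smul_eq_mul, hdet w v, hdet t v]
    field_simp
  have hfs : ∀ x, f x • s.1 x = u.1 x := fun x => key (u.1 x) (s.1 x) (hs x)
  -- The fixed basis `b` need not give a smooth frame of the tangent spaces. The ratio of two
  -- top-degree forms does not depend on the frame, so it can be read off in any chart, where it is
  -- smooth.
  have hloc : ∀ x₀ : M, ∀ y ∈ (extChartAt (𝓡 (m + 1)) x₀).target,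
      f ((extChartAt (𝓡 (m + 1)) x₀).symm y) = localForm u.1 x₀ y b / localForm s.1 x₀ y b := by
    intro x₀ y hy
    rw [eq_div_iff (hne _ (localForm_ne_zero hs hy))]
    have h1 := hfs ((extChartAt (𝓡 (m + 1)) x₀).symm y)
    unfold localForm
    rw [← h1]
    rfl
  refine ⟨⟨fun x => ContinuousAlternatingMap.constOfIsEmpty ℝ
    (EuclideanSpace ℝ (Fin (m + 1))) (Fin 0) (f x), fun x₀ => contDiffOn_alternating fun _ => ?_⟩,
    Subtype.ext (funext fun x => hfs x)⟩
  refine ContDiffOn.congr (f := fun y => localForm u.1 x₀ y b / localForm s.1 x₀ y b) ?_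
    fun y hy => hloc x₀ y hy
  exact (contDiffOn_alternating_apply (u.2 x₀) fun _ => contDiffOn_const).div
    (contDiffOn_alternating_apply (s.2 x₀) fun _ => contDiffOn_const)
    fun y hy => hne _ (localForm_ne_zero hs hy)

/-- On a curve, a field of finite type preserving a volume form has no zeros. -/
lemma zeros_eq_empty_of_lieD_eq_zero (hn : n = 1)
    (hX : ∀ x ∈ zeros X, ∀ᶠ y in 𝓝[≠] x, y ∉ zeros X) {s : forms n M 1} (hs : ∀ x, s.1 x ≠ 0)
    (h0 : lieD X 1 s = 0) : zeros X = ∅ := by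
  refine Set.eq_empty_iff_forall_notMem.2 fun x hx => ?_
  subst hn
  set a := extChartAt (𝓡 1) x x with ha
  rw [lieD_top X rfl] at h0
  set h := iota X 0 s with hh
  have hder : ∀ y ∈ (extChartAt (𝓡 1) x).target, fderiv ℝ (localForm h.1 x) y = 0 := by
    intro y hy
    have h1 := localForm_extDerivAt h.2 hy
    have h2 : extDerivAt h.1 = (0 : FormField 1 M 1) := congrArg Subtype.val h0
    rw [h2] at h1
    have h3 : extDeriv (localForm h.1 x) y = 0 := h1.symm
    refine ContinuousLinearMap.ext fun v => ?_
    rw [← curryLeft_alternatizeUncurryFin_zero]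
    change (extDeriv (localForm h.1 x) y).curryLeft v = 0
    rw [h3]
    rfl
  obtain ⟨ε, hε, hεt⟩ := Metric.mem_nhds_iff.1 (extChartAt_target_mem_nhds (I := 𝓡 1) x)
  have hconst : ∀ y ∈ Metric.ball a ε, localForm h.1 x y = localForm h.1 x a := fun y hy =>
    Metric.isOpen_ball.is_const_of_fderiv_eq_zero (convex_ball a ε).isPreconnected
      (((h.2 x).mono hεt).differentiableOn (by simp)) (fun z hz => hder z (hεt hz)) hy
      (Metric.mem_ball_self hε)
  have hXa : localField X x a = 0 := (localField_self_eq_zero_iff X x).2 hx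
  have hcon : ∀ y ∈ (extChartAt (𝓡 1) x).target,
      localForm h.1 x y = (localForm s.1 x y).curryLeft (localField X x y) :=
    fun y hy => localForm_contractAt X s.1 hy
  -- The closed function `i_X s` is constant on the ball and zero at its centre. A nonzero 1-form in
  -- dimension one kills no nonzero vector, so `X` vanishes on the whole ball, against isolatedness.
  have hzero : ∀ y ∈ Metric.ball a ε, localField X x y = 0 := by
    intro y hy
    by_contra hne
    refine localForm_ne_zero hs (hεt hy) (eq_zero_of_curryLeft (by simp) hne ?_)
    rw [← hcon y (hεt hy), hconst y hy, hcon a (mem_extChartAt_target x), hXa, map_zero]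
  have hev := (eventually_localField_ne_zero X (hX x hx)).and (Metric.ball_mem_nhds a hε)
  have hev' : ∀ᶠ y in 𝓝[≠] a, False := by
    filter_upwards [hev.filter_mono nhdsWithin_le_nhds, self_mem_nhdsWithin] with y hy hya
    exact hy.1 hya (hzero y hy.2)
  have : (𝓝[≠] a).NeBot := Module.punctured_nhds_neBot ℝ (EuclideanSpace ℝ (Fin 1)) a
  exact hev'.exists.elim fun _ => id

/-- The isomorphism `H_X^n ≅ C_X^{n-1}` for fields with isolated zeros. -/
lemma exists_H_equiv_C {m : ℕ} (hn : n = m + 1)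
    (hX : ∀ x ∈ zeros X, ∀ᶠ y in 𝓝[≠] x, y ∉ zeros X) :
    ∃ e : H X (m + 1) ≃ₗ[ℝ] C X m, ∀ u : closedForms n M (m + 1),
      (e (Submodule.Quotient.mk u) : CokerX X m) = Submodule.Quotient.mk (iotaX X m u.1) := by
  let φ : closedForms n M (m + 1) →ₗ[ℝ] C X m :=
    LinearMap.codRestrict (C X m) ((LinearMap.range (lieDX X m)).mkQ ∘ₗ iotaX X m ∘ₗ
      (closedForms n M (m + 1)).subtype) fun u => ⟨_, ⟨u.1, rfl⟩, rfl⟩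
  have hker : LinearMap.ker φ = (exactX X (m + 1)).submoduleOf (closedForms n M (m + 1)) := by
    ext u
    rw [LinearMap.mem_ker]
    change φ u = 0 ↔ u.1 ∈ exactX X (m + 1)
    have h1 : φ u = 0 ↔ iotaX X m u.1 ∈ LinearMap.range (lieDX X m) := by
      rw [← Submodule.Quotient.mk_eq_zero, ← Subtype.coe_inj]
      rfl
    rw [h1]
    constructor
    · rintro ⟨w, hw⟩
      refine ⟨w.1, w.2, ?_⟩
      have h2 : iota X m (extD m w.1) = iota X m u.1 := by
        rw [← lieD_of_mem X w.2]
        exact congrArg Subtype.val hw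
      -- From `i_X dw = i_X u`, the top-degree forms `dw` and `u` agree where `X ≠ 0`, which
      -- suffices by density.
      refine forms_ext_of_isolated X (by omega) hX fun x hx => ?_
      rw [← sub_eq_zero]
      refine eq_zero_of_curryLeft (E := EuclideanSpace ℝ (Fin n)) (v := X x) (by simpa using hn) hx ?_
      have h3 : evalAt n M m x (iota X m (extD m w.1 - u.1)) = 0 := by
        rw [map_sub, h2, sub_self, map_zero]
      exact h3
    · rintro ⟨w, hw, hwu⟩
      refine ⟨⟨w, hw⟩, Subtype.ext ?_⟩
      change lieD X m w = iota X m u.1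
      rw [lieD_of_mem X hw, hwu]
  have hsurj : Function.Surjective φ := by
    rintro ⟨_, ⟨_, ⟨u, rfl⟩, rfl⟩⟩
    exact ⟨⟨u, mem_closedForms hn _⟩, rfl⟩
  obtain ⟨e, he⟩ := exists_quotient_equiv φ hker hsurj
  exact ⟨e, fun u => congrArg Subtype.val (he u)⟩

lemma exists_H_equiv_Coker {m : ℕ} (hn : n = m + 1)
    (h : exactX X (m + 1) = LinearMap.range (lieD X (m + 1))) :
    ∃ e : H X (m + 1) ≃ₗ[ℝ] Coker X (m + 1), ∀ u : closedForms n M (m + 1),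
      e (Submodule.Quotient.mk u) = Submodule.Quotient.mk u.1 := by
  refine exists_quotient_equiv ((LinearMap.range (lieD X (m + 1))).mkQ ∘ₗ
    (closedForms n M (m + 1)).subtype) ?_ ?_
  · rw [LinearMap.ker_comp, Submodule.ker_mkQ, ← h]
    rfl
  · intro v
    obtain ⟨u, rfl⟩ := Submodule.mkQ_surjective _ v
    exact ⟨⟨u, mem_closedForms hn _⟩, rfl⟩

/-- An invariant volume form identifies `Coker(∇_X^0)` with `H_X^n`. -/
lemma exists_Coker_equiv_H {m : ℕ} (hn : n = m + 1)
    (h : exactX X (m + 1) = LinearMap.range (lieD X (m + 1))) {s : forms n M (m + 1)}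
    (hs : ∀ x, s.1 x ≠ 0) (h0 : lieD X (m + 1) s = 0) :
    ∃ e : Coker X 0 ≃ₗ[ℝ] H X (m + 1),
      ∀ (f : forms n M 0) (u : closedForms n M (m + 1)), u.1 = mulForm f s →
        e (Submodule.Quotient.mk f) = Submodule.Quotient.mk u := by
  have hcl : ∀ u : forms n M (m + 1), u ∈ closedForms n M (m + 1) := mem_closedForms hn
  -- Multiplication by `s` intertwines the Lie derivatives in degrees 0 and `n`; being bijective, it
  -- matches their images.
  have hL : ∀ g : forms n M 0, lieD X (m + 1) (mulForm g s) = mulForm (lieD X 0 g) s := by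
    intro g
    rw [lieD_mulForm X hn, h0]
    have h1 : mulForm g (0 : forms n M (m + 1)) = 0 :=
      Subtype.ext (funext fun x => smul_zero (g.1 x 0))
    rw [h1, add_zero]
  let μ : forms n M 0 →ₗ[ℝ] closedForms n M (m + 1) :=
    { toFun := fun f => ⟨mulForm f s, hcl _⟩
      map_add' := fun f g => Subtype.ext (Subtype.ext (funext fun x =>
        add_smul (f.1 x 0) (g.1 x 0) (s.1 x)))
      map_smul' := fun c f => Subtype.ext (Subtype.ext (funext fun x =>
        mul_smul c (f.1 x 0) (s.1 x))) }
  let φ := ((exactX X (m + 1)).submoduleOf (closedForms n M (m + 1))).mkQ ∘ₗ μ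
  have hker : LinearMap.ker φ = LinearMap.range (lieD X 0) := by
    rw [LinearMap.ker_comp, Submodule.ker_mkQ]
    ext f
    change mulForm f s ∈ exactX X (m + 1) ↔ _
    rw [h]
    constructor
    · rintro ⟨u, hu⟩
      obtain ⟨g, rfl⟩ := exists_mulForm_eq hn hs u
      rw [hL] at hu
      exact ⟨g, mulForm_injective hs hu⟩
    · rintro ⟨g, rfl⟩
      exact ⟨mulForm g s, hL g⟩
  have hsurj : Function.Surjective φ := (Submodule.mkQ_surjective _).comp fun u => by
    obtain ⟨f, hf⟩ := exists_mulForm_eq hn hs u.1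
    exact ⟨f, Subtype.ext hf⟩
  obtain ⟨e, he⟩ := exists_quotient_equiv φ hker hsurj
  refine ⟨e, fun f u hu => ?_⟩
  rw [he, ← (Subtype.ext hu.symm : μ f = u)]
  rfl

end top

/-! ### The codimension of `C_X^0`. -/

section codimension

variable {n : ℕ} {M : Type*} [TopologicalSpace M]
  [ChartedSpace (EuclideanSpace ℝ (Fin n)) M] [IsManifold (𝓡 n) ∞ M]
  (X : Field n M)

/-- The codimension of `C_X^0` is the codimension of the image of `i_X` in the functions. -/
lemma exists_quotient_C_equiv :
    Nonempty ((CokerX X 0 ⧸ C X 0) ≃ₗ[ℝ] (forms n M 0 ⧸ LinearMap.range (iota X 0))) := by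
  have e1 : (CokerX X 0 ⧸ C X 0) ≃ₗ[ℝ] (lambdaX X 0 ⧸ LinearMap.range (iotaX X 0)) :=
    Submodule.quotientQuotientEquivQuotient _ _ (range_lieDX_le X 0)
  have e2 : (lambdaX X 0 ⧸ LinearMap.range (iotaX X 0)) ≃ₗ[ℝ]
      (forms n M 0 ⧸ LinearMap.range (iota X 0)) := by
    refine Submodule.Quotient.equiv _ _ (LinearEquiv.ofTop (lambdaX X 0) rfl) ?_
    rw [← LinearMap.range_comp]
    rfl
  exact ⟨e1.trans e2⟩

variable [T2Space M] [SigmaCompactSpace M]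

/-- The image of `i_X` in degree `0` for fields with non-degenerate zeros. -/
lemma mem_range_iota_zero_iff (h : ∀ x ∈ zeros X, IsNondegenerateAt X x) (f : forms n M 0) :
    f ∈ LinearMap.range (iota X 0) ↔ ∀ x ∈ zeros X, f.1 x = 0 := by
  constructor
  · rintro ⟨u, rfl⟩ x hx
    have hx : X x = 0 := hx
    have h1 : ∀ (w : EuclideanSpace ℝ (Fin n) [⋀^Fin 1]→L[ℝ] ℝ) (v : EuclideanSpace ℝ (Fin n)),
        v = 0 → w.curryLeft v = 0 := fun w v hv => by rw [hv, map_zero]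
    exact h1 (u.1 x) (X x) hx
  · exact fun h0 => mem_range_iota_of_nondegenerate X h (k := 0) trivial fun _ => h0

variable (n M) in
/-- Evaluation of functions at a finite set of points. -/
def evalFinset (s : Finset M) : forms n M 0 →ₗ[ℝ] (s → ℝ) where
  toFun f p := f.1 p 0
  map_add' _ _ := rfl
  map_smul' _ _ := rfl

/-- Smooth functions separate each point of a finite set from the others, giving preimages of the
standard basis. -/
lemma evalFinset_surjective (s : Finset M) : Function.Surjective (evalFinset n M s) := by
  classical
  have hδ : ∀ p : s, ∃ f : forms n M 0, evalFinset n M s f = Pi.single p 1 := by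
    intro p
    obtain ⟨f, hf0, hf1, -⟩ := exists_contMDiffMap_zero_one_of_isClosed (n := ⊤) (𝓡 n)
      (s := ((s.erase p.1 : Finset M) : Set M)) (t := {p.1}) (Finset.finite_toSet _).isClosed
      isClosed_singleton (by simp)
    refine ⟨funForm f f.contMDiff, funext fun q => ?_⟩
    by_cases hq : q = p
    · subst hq
      rw [Pi.single_eq_same]
      exact hf1 rfl
    · rw [Pi.single_eq_of_ne hq]
      exact hf0 (by simp [hq])
  choose δ hδ using hδ
  intro c
  refine ⟨∑ p, c p • δ p, ?_⟩
  simp only [map_sum, map_smul, hδ]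
  exact (pi_eq_sum_univ' c).symm

/-- Evaluation at a finite set of zeros kills `Im i_X` and is onto, which bounds the rank from
below. If there are finitely many zeros, evaluating at all of them has kernel exactly `Im i_X`. -/
lemma rank_quotient_C (h : ∀ x ∈ zeros X, IsNondegenerateAt X x) :
    Cardinal.toENat (Module.rank ℝ (CokerX X 0 ⧸ C X 0)) = (zeros X).encard ∧
      ((zeros X).Finite → FiniteDimensional ℝ (CokerX X 0 ⧸ C X 0)) := by
  obtain ⟨e⟩ := exists_quotient_C_equiv X
  rw [e.rank_eq]
  have hle : ∀ s : Finset M, (s : Set M) ⊆ zeros X →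
      LinearMap.range (iota X 0) ≤ LinearMap.ker (evalFinset n M s) := by
    intro s hs f hf
    refine funext fun p => ?_
    have h1 := (mem_range_iota_zero_iff X h f).1 hf p.1 (hs p.2)
    change f.1 p 0 = 0
    rw [h1]
    rfl
  have hrank : ∀ s : Finset M, (s : Set M) ⊆ zeros X →
      (s.card : Cardinal) ≤ Module.rank ℝ (forms n M 0 ⧸ LinearMap.range (iota X 0)) := by
    intro s hs
    have h1 := LinearMap.lift_rank_le_of_surjective
      ((LinearMap.range (iota X 0)).liftQ (evalFinset n M s) (hle s hs)) fun c => by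
        obtain ⟨f, hf⟩ := evalFinset_surjective (n := n) s c
        exact ⟨Submodule.Quotient.mk f, hf⟩
    simpa using h1
  by_cases hz : (zeros X).Finite
  · have hs : ((hz.toFinset : Finset M) : Set M) = zeros X := hz.coe_toFinset
    have hker : LinearMap.ker (evalFinset n M hz.toFinset) = LinearMap.range (iota X 0) := by
      refine le_antisymm (fun f hf => (mem_range_iota_zero_iff X h f).2 fun x hx => ?_)
        (hle _ hs.le)
      have h1 : f.1 x 0 = 0 := congrFun (show evalFinset n M hz.toFinset f = 0 from hf)
        ⟨x, hz.mem_toFinset.2 hx⟩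
      refine ContinuousAlternatingMap.ext (M := EuclideanSpace ℝ (Fin n)) fun v => ?_
      rw [Subsingleton.elim v 0]
      exact h1
    obtain ⟨e', -⟩ := exists_quotient_equiv _ hker (evalFinset_surjective hz.toFinset)
    refine ⟨?_, fun _ => (e.trans e').symm.finiteDimensional⟩
    have hc := e'.lift_rank_eq
    rw [rank_fun', Cardinal.lift_natCast, Fintype.card_coe] at hc
    have hc' : Module.rank ℝ (forms n M 0 ⧸ LinearMap.range (iota X 0)) =
        (hz.toFinset.card : Cardinal) := by
      rw [← Cardinal.lift_inj, hc, Cardinal.lift_natCast]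
    rw [hc', Cardinal.toENat_nat, hz.encard_eq_coe_toFinset_card]
  -- Finite sets of zeros of every size make the rank infinite, and `Cardinal.toENat` sends every
  -- infinite cardinal to `⊤`.
  · refine ⟨?_, fun h => absurd h hz⟩
    rw [Set.encard_eq_top hz, Cardinal.toENat_eq_top, Cardinal.aleph0_le]
    intro N
    obtain ⟨s, hs, hcard⟩ := (Set.Infinite.exists_subset_card_eq hz N)
    rw [← hcard]
    exact hrank s hs

end codimension

end Novikov

end

theorem proposition1 {n : ℕ} {M : Type*} [TopologicalSpace M]
    [ChartedSpace (EuclideanSpace ℝ (Fin n)) M] [IsManifold (𝓡 n) ∞ M]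
    [T2Space M] [SigmaCompactSpace M] (X : Novikov.Field n M) :
    -- top degree `n = m + 1`, fields of finite type
    (∀ m : ℕ, n = m + 1 → Novikov.IsFiniteType X →
      -- all `n`-forms are closed, so `H_X^n` is a quotient of `Λ^n`
      Novikov.closedForms n M (m + 1) = ⊤ ∧
      -- `i_X` induces an isomorphism `H_X^n ≅ C_X^{n-1}`
      (∃ e : Novikov.H X (m + 1) ≃ₗ[ℝ] Novikov.C X m,
        ∀ u : Novikov.closedForms n M (m + 1),
          (e (Submodule.Quotient.mk u) : Novikov.CokerX X m) =
            Submodule.Quotient.mk (Novikov.iotaX X m u.1)) ∧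
      -- the identity of `Λ^n` induces `H_X^n = Coker(∇_X^n)`
      (1 < n ∨ Novikov.zeros X = ∅ →
        Novikov.exactX X (m + 1) = LinearMap.range (Novikov.lieD X (m + 1)) ∧
        ∃ e : Novikov.H X (m + 1) ≃ₗ[ℝ] Novikov.Coker X (m + 1),
          ∀ u : Novikov.closedForms n M (m + 1),
            e (Submodule.Quotient.mk u) = Submodule.Quotient.mk u.1) ∧
      -- for an invariant volume form `σ`, the map `f ↦ f σ` induces `Coker(∇_X^0) ≅ H_X^n`
      (∀ σ : Novikov.forms n M (m + 1), (∀ x, σ.1 x ≠ 0) → Novikov.lieD X (m + 1) σ = 0 →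
        ∃ e : Novikov.Coker X 0 ≃ₗ[ℝ] Novikov.H X (m + 1),
          ∀ (f : Novikov.forms n M 0) (u : Novikov.closedForms n M (m + 1)),
            u.1 = Novikov.mulForm f σ →
              e (Submodule.Quotient.mk f) = Submodule.Quotient.mk u)) ∧
    -- non-vanishing fields
    (Novikov.zeros X = ∅ → ∀ k : ℕ, Novikov.C X k = ⊤) ∧
    -- fields with non-degenerate zeros
    ((∀ x ∈ Novikov.zeros X, Novikov.IsNondegenerateAt X x) →
      (∀ k : ℕ, 0 < k → Novikov.C X k = ⊤) ∧
      (∀ f : Novikov.forms n M 0,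
        f ∈ LinearMap.range (Novikov.iota X 0) ↔ ∀ x ∈ Novikov.zeros X, f.1 x = 0) ∧
      Cardinal.toENat (Module.rank ℝ (Novikov.CokerX X 0 ⧸ Novikov.C X 0)) =
        (Novikov.zeros X).encard ∧
      ((Novikov.zeros X).Finite → FiniteDimensional ℝ (Novikov.CokerX X 0 ⧸ Novikov.C X 0))) := by
  refine ⟨fun m hn hX => ?_, fun hX k => Novikov.C_eq_top X
    (Novikov.lambdaX_le_of_zeros_empty X hX k), fun hX => ⟨fun k hk => ?_,
    Novikov.mem_range_iota_zero_iff X hX, Novikov.rank_quotient_C X hX⟩⟩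
  · have hiso : ∀ x ∈ Novikov.zeros X, ∀ᶠ y in 𝓝[≠] x, y ∉ Novikov.zeros X :=
      fun x hx => (hX x hx).1
    have hex : 1 < n ∨ Novikov.zeros X = ∅ →
        Novikov.exactX X (m + 1) = LinearMap.range (Novikov.lieD X (m + 1)) := by
      intro h
      refine Novikov.exactX_eq_range_lieD X hn ?_
      rcases h with h | h
      · obtain ⟨k, rfl⟩ : ∃ k, m = k + 1 := ⟨m - 1, by omega⟩
        exact Novikov.lambdaX_le_of_isFiniteType X hn hX
      · exact Novikov.lambdaX_le_of_zeros_empty X h m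
    refine ⟨Novikov.closedForms_eq_top hn, Novikov.exists_H_equiv_C X hn hiso,
      fun h => ⟨hex h, Novikov.exists_H_equiv_Coker X hn (hex h)⟩, fun σ hσ hL => ?_⟩
    refine Novikov.exists_Coker_equiv_H X hn (hex ?_) hσ hL
    -- Dimension one lacks the two coordinates used for exactness; there the invariant volume form
    -- rules out zeros.
    rcases Nat.eq_zero_or_pos m with rfl | hm
    · exact Or.inr (Novikov.zeros_eq_empty_of_lieD_eq_zero X hn hiso hσ hL)
    · exact Or.inl (by omega)
  · exact Novikov.C_eq_top X fun u hu =>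
      Novikov.mem_range_iota_of_nondegenerate X hX hu fun h0 => absurd h0 hk.ne'
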